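/- **Setting.** Let $d\ge 2$, $n_1,\dots,n_d\ge 1$. For a rank vector $\mathbf r=(r_0,\dots,r_d)$ with $r_0=r_d=1$ and all $r_k\ge1$, TT-cores $G=(G_1,\dots,G_d)$ of ranks $\mathbf r$ are arrays $G_k\in\mathbb R^{r_{k-1}\times n_k\times r_k}$; they define the tensor with entries $X_{i_1\dots i_d}=G_1[i_1]\cdots G_d[i_d]$. $\mathcal M_{\mathbf r}$ is the manifold of tensors whose $k$-th unfolding has rank $r_k$ for $k=1,\dots,d-1$. An orthogonalization of $X$ consists of left-orthogonal cores $U_1,\dots,U_{d-1}$, right-orthogonal cores $V_2,\dots,V_d$ and cores $S_1,\dots,S_d$ with $X=U_1\cdots U_{\mu-1}S_\mu V_{\mu+1}\cdots V_d$ for every $\mu$. The tangent space $T_X\mathcal M_{\mathbf r}$ is the set of all $\mathcal T_X(\delta)=\sum_{k}U_1\cdots U_{k-1}\,\delta_k\,V_{k+1}\cdots V_d$, each element having delta terms that satisfy the gauge conditions $\sum_i U_k[i]^{\top}\delta_k[i]=0$, $k<d$. $\mathrm P_X$ is the orthogonal projection onto $T_X\mathcal M_{\mathbf r}$. $\mathcal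 T_X(\delta)$ has TT-cores $[\delta_1\;U_1]$, $\begin{bmatrix}V_k&0\\ \delta_k&U_k\end{bmatrix}$, $\begin{bmatrix}V_d\\ \delta_d\end{bmatrix}$ of ranks $\widehat{\mathbf r}=(1,2r_1,\dots,2r_{d-1},1)$. **Programs.** A program is a sequence of elementary operations ($+,-,\times,/,\sqrt{\cdot},\exp,\log,\sin,\cos,\arctan$, one FLOP each; constants are free). Let $f$ be a smooth real function on an open set $D\subseteq\mathbb R^{n_1\times\dots\times n_d}$ (for instance the whole space), and let $p$ be a family of programs, one for each rank vector $\mathbf r$, which takes TT-cores of ranks $\mathbf r$ of any tensor $X\in D$ and returns $f(X)$, applying every operation at a point where it is defined and smooth, in at most $F(\mathbf r)$ FLOP. Assume that $F$ is polynomial in the ranks: for some polynomial $P$ with nonnegative coefficients, of total degree at most $q$, and a constant $K$, $P(\mathbf r)\le F(\mathbf r)\le K\,P(\mathbf r)$ for all rank vectors $\mathbf r$. **Algorithm.** Input: TT-cores $G$ of ranks $\mathbf r$ of a tensor $X$ and delta terms $\delta^Z$ of a tangent vector $Z$. 1. Compute an orthogonalization $U,S,V$ of $X$ from $G$ (one left-to-right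 and one right-to-left sweep of QR decompositions). 2. Let $g(R_1,\dots,R_d)$ be the program that runs $p$ on the above TT-cores of $\mathcal T_X(R)$. 3. Let $w(R_1,\dots,R_d)$ be the program that computes $D_k=\partial g/\partial R_k$ by reverse-mode automatic differentiation, with $U,V$ held fixed (stop-gradient), replaces $D_k$ by $D_k-U_k(U_k^{\top}D_k)$ (left unfoldings) for $k<d$, and returns $\sum_k\langle D_k,\delta^Z_k\rangle$. 4. Compute $D_k=\partial w/\partial R_k$ at $R=(S_1,0,\dots,0)$ by reverse-mode automatic differentiation, replace $D_k$ by $D_k-U_k(U_k^{\top}D_k)$ for $k<d$, and output the TT-cores (of ranks $\widehat{\mathbf r}$) of $\mathcal T_X(D)$. **Theorem.** There is a constant $C$ depending only on $q$ and $K$ such that for all $d,n_1,\dots,n_d,D,f,p,F$ as above and every rank vector $\mathbf r$, the algorithm takes at most $C\,(F(\mathbf r)+d\,n\,r^3)$ FLOP, where $n=\max_{1\le k\le d}n_k$ and $r=\max_{1\le k\le d-1}r_k$. Moreover, for all TT-cores $G$ of ranks $\mathbf r$ of a tensor $X\in\mathcal M_{\mathbf r}\cap D$, step 1 produces an orthogonalization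 of $X$; every $Z\in T_X\mathcal M_{\mathbf r}$ has delta terms satisfying the gauge conditions; and for all such delta terms of $Z$, the program $w$ computes $w(R)=\langle \mathrm P_X\nabla f(\mathcal T_X(R)),Z\rangle$, with $\mathrm P_X$ fixed, whenever $\mathcal T_X(R)\in D$, all operations of the algorithm are well defined, and its output is a family of TT-cores of $\mathrm P_X\nabla^2 f(X)\,Z$, the approximate Riemannian Hessian (curvature term omitted) applied to $Z$. -/

import Mathlib

open scoped ContDiff InnerProductSpace

namespace TTAD

noncomputable section

/-! ### Straight-line programs, their FLOP count and reverse-mode automatic differentiation -/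

/-- Elementary operations on the variables `V` in scope. -/
inductive Op (V : Type) : Type
  | const (c : ℝ)
  | add (a b : V)
  | sub (a b : V)
  | mul (a b : V)
  | div (a b : V)
  | sqrt (a : V)
  | exp (a : V)
  | log (a : V)
  | sin (a : V)
  | cos (a : V)
  | arctan (a : V)

namespace Op

def rename {V W : Type} (φ : V → W) : Op V → Op W
  | const c => const c
  | add a b => add (φ a) (φ b)
  | sub a b => sub (φ a) (φ b)
  | mul a b => mul (φ a) (φ b)
  | div a b => div (φ a) (φ b)
  | sqrt a => sqrt (φ a)
  | exp a => exp (φ a)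
  | log a => log (φ a)
  | sin a => sin (φ a)
  | cos a => cos (φ a)
  | arctan a => arctan (φ a)

def eval {V : Type} (x : V → ℝ) : Op V → ℝ
  | const c => c
  | add a b => x a + x b
  | sub a b => x a - x b
  | mul a b => x a * x b
  | div a b => x a / x b
  | sqrt a => Real.sqrt (x a)
  | exp a => Real.exp (x a)
  | log a => Real.log (x a)
  | sin a => Real.sin (x a)
  | cos a => Real.cos (x a)
  | arctan a => Real.arctan (x a)

/-- The operation is applied at a point where it is defined and smooth. -/
def Regular {V : Type} (x : V → ℝ) : Op V → Prop
  | div _ b => x b ≠ 0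
  | sqrt a => 0 < x a
  | log a => 0 < x a
  | _ => True

/-- Every operation is one FLOP; writing down a constant is free. -/
def cost {V : Type} : Op V → ℕ
  | const _ => 0
  | _ => 1

end Op

/-- Straight-line programs (computational graphs) with input variables `V` and outputs `O`.
`step op rest` evaluates `op`, stores the value in the new variable `none`, and continues with
`rest`; `ret out` stops and returns the variables `out`. -/
inductive Prog : Type → Type → Type 1
  | ret {V O : Type} (out : O → V) : Prog V O
  | step {V O : Type} (op : Op V) (rest : Prog (Option V) O) : Prog V O

namespace Prog

/-- The values returned on the input `x`. -/
def eval {V O : Type} : Prog V O → (V → ℝ) → O → ℝ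
  | ret out, x => fun o => x (out o)
  | step op rest, x => rest.eval (fun v => v.elim (op.eval x) x)

/-- On the input `x`, every operation of the run is applied where it is defined and smooth. -/
def Regular {V O : Type} : Prog V O → (V → ℝ) → Prop
  | ret _, _ => True
  | step op rest, x => op.Regular x ∧ rest.Regular (fun v => v.elim (op.eval x) x)

/-- Number of floating point operations of a run. -/
def cost {V O : Type} : Prog V O → ℕ
  | ret _ => 0
  | step op rest => op.cost + rest.cost

/-- Run a program on other variables (a subroutine call). -/
def rename {V O : Type} : Prog V O → {W : Type} → (V → W) → Prog W O
  | ret out, _, φ => ret (fun o => φ (out o))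
  | step op rest, _, φ => step (op.rename φ) (rest.rename (Option.map φ))

/-- Run `p`, then `q`, which sees the variables of `p` (as `inl`) and the results of `p`
(as `inr`). -/
def bind {V O P : Type} : Prog V O → Prog (V ⊕ O) P → Prog V P
  | ret out, q => q.rename (Sum.elim id out)
  | step op rest, q => step op (rest.bind (q.rename (Sum.map some id)))

/-- Rearrange (select, copy) the results. -/
def outMap {V O P : Type} (p : Prog V O) (φ : P → O) : Prog V P :=
  p.bind (ret (fun o => Sum.inr (φ o)))

/-- A single operation. -/
def op {V : Type} (o : Op V) : Prog V Unit :=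
  step o (ret (fun _ => none))

/-! #### Reverse mode -/

open Classical in
/-- Adjoint update `ā += c`, where `adj` tells where the adjoints are stored. -/
def acc {V W : Type} (adj : V → W) (a : V) (c : W) : Prog W V :=
  step (.add (adj a) c) (ret (fun v => if v = a then none else some (adj v)))

open Classical in
/-- Adjoint updates `ā += c`, then `b̄ += e`. -/
def acc₂ {V W : Type} (adj : V → W) (a : V) (c : W) (b : V) (e : W) : Prog W V :=
  step (.add (adj a) c) (acc (fun v => if v = a then none else some (adj v)) b (some e))

/-- One step of the reverse pass through `y = op`. The context consists of the values (`inl`) and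
the adjoints (`inr`) of all variables including `y = none`; the results are the adjoints of the
variables other than `y`, each increased by `ȳ · ∂y/∂v`. -/
def pullback {V : Type} : Op V → Prog (Option V ⊕ Option V) V
  | .const _ => ret (fun v => .inr (some v))
  | .add a b => acc₂ (fun v => .inr (some v)) a (.inr none) b (.inr none)
  | .sub a b =>
      step (.const 0) <|
      step (.sub none (some (.inr none))) <|
      acc₂ (fun v => some (some (.inr (some v)))) a (some (some (.inr none))) b none
  | .mul a b =>
      step (.mul (.inr none) (.inl (some b))) <|
      step (.mul (some (.inr none)) (some (.inl (some a)))) <|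
      acc₂ (fun v => some (some (.inr (some v)))) a (some none) b none
  | .div a b =>
      step (.div (.inr none) (.inl (some b))) <|
      step (.mul none (some (.inl none))) <|
      step (.const 0) <|
      step (.sub none (some none)) <|
      acc₂ (fun v => some (some (some (some (.inr (some v)))))) a (some (some (some none))) b none
  | .sqrt a =>
      step (.add (.inl none) (.inl none)) <|
      step (.div (some (.inr none)) none) <|
      acc (fun v => some (some (.inr (some v)))) a none
  | .exp a =>
      step (.mul (.inr none) (.inl none)) <|
      acc (fun v => some (.inr (some v))) a none
  | .log a =>
      step (.div (.inr none) (.inl (some a))) <|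
      acc (fun v => some (.inr (some v))) a none
  | .sin a =>
      step (.cos (.inl (some a))) <|
      step (.mul (some (.inr none)) none) <|
      acc (fun v => some (some (.inr (some v)))) a none
  | .cos a =>
      step (.sin (.inl (some a))) <|
      step (.mul (some (.inr none)) none) <|
      step (.const 0) <|
      step (.sub none (some none)) <|
      acc (fun v => some (some (some (some (.inr (some v)))))) a none
  | .arctan a =>
      step (.mul (.inl (some a)) (.inl (some a))) <|
      step (.const 1) <|
      step (.add none (some none)) <|
      step (.div (some (some (some (.inr none)))) none) <|
      acc (fun v => some (some (some (some (.inr (some v)))))) a none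

open Classical in
/-- Reverse-mode automatic differentiation (backpropagation) of a program with one output: run the
program forwards, set the adjoint of its output to `1` and all others to `0`, and go backwards
through the operations. The results are the partial derivatives with respect to all inputs. -/
def grad {V : Type} : Prog V Unit → Prog V V
  | ret out =>
      step (.const 0) <| step (.const 1) <|
      ret (fun v => if v = out () then none else some none)
  | step o rest => step o (rest.grad.bind (pullback o))

/-! #### Loops and vector operations -/

def vecFin {V : Type} : (m : ℕ) → (Fin m → Prog V Unit) → Prog V (Fin m)
  | 0, _ => ret (fun i => i.elim0)
  | m + 1, p =>
      (p 0).bind <|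
      ((vecFin m (fun i => p i.succ)).rename Sum.inl).bind <|
      ret (fun i => Fin.cases (.inl (.inr ())) (fun j => .inr j) i)

/-- Compute an array entry by entry. -/
def vec {V ι : Type} [Fintype ι] (p : ι → Prog V Unit) : Prog V ι :=
  (vecFin (Fintype.card ι) (fun i => p ((Fintype.equivFin ι).symm i))).outMap (Fintype.equivFin ι)

def dotFin {V : Type} : (m : ℕ) → (Fin m → V) → (Fin m → V) → Prog V Unit
  | 0, _, _ => op (.const 0)
  | m + 1, a, b =>
      (dotFin m (fun i => a i.succ) (fun i => b i.succ)).bind <|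
      step (.mul (.inl (a 0)) (.inl (b 0))) <|
      op (.add (some (.inr ())) none)

/-- Dot product `∑ i, a i * b i`. -/
def dot {V ι : Type} [Fintype ι] (a b : ι → V) : Prog V Unit :=
  dotFin (Fintype.card ι) (fun i => a ((Fintype.equivFin ι).symm i))
    (fun i => b ((Fintype.equivFin ι).symm i))

/-- Run `body 0, …, body (m - 1)` one after the other on a state `S`. -/
def loop {V S : Type} : (m : ℕ) → (Fin m → Prog (V ⊕ S) S) → Prog (V ⊕ S) S
  | 0, _ => ret Sum.inr
  | m + 1, body =>
      (body 0).bind <|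
      (loop m (fun i => body i.succ)).rename (Sum.map Sum.inl id)

/-- Left-to-right sweep over the positions `0, …, m - 1` between the bonds `0, …, m`. The body at
position `k` turns the state at the bond before `k` into the state at the bond after `k` and an
output at `k`. All states and outputs are returned. -/
def sweepRight {V : Type} : (m : ℕ) → (A : Fin (m + 1) → Type) → (B : Fin m → Type) →
    Prog V (A 0) → (∀ k : Fin m, Prog (V ⊕ A k.castSucc) (A k.succ ⊕ B k)) →
    Prog V ((Σ k, A k) ⊕ (Σ k, B k))
  | 0, A, _, init, _ =>
      init.outMap (Sum.elim
        (fun s => Fin.cases (motive := fun k => A k → A 0) id (fun k _ => k.elim0) s.1 s.2)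
        (fun s => s.1.elim0))
  | m + 1, A, B, init, body =>
      init.bind <|
      (body 0).bind <|
      (sweepRight m (fun k => A k.succ) (fun k => B k.succ)
        (ret (fun a => .inr (.inl a)))
        (fun k => (body k.succ).rename (Sum.map (fun v => .inl (.inl v)) id))).bind <|
      ret (Sum.elim
        (fun s => Fin.cases (motive := fun k => A k → ((V ⊕ A 0) ⊕ (A (Fin.succ 0) ⊕ B 0)) ⊕
            ((Σ k : Fin (m + 1), A k.succ) ⊕ (Σ k : Fin m, B k.succ)))
          (fun a => .inl (.inl (.inr a))) (fun k a => .inr (.inl ⟨k, a⟩)) s.1 s.2)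
        (fun s => Fin.cases (motive := fun k => B k → ((V ⊕ A 0) ⊕ (A (Fin.succ 0) ⊕ B 0)) ⊕
            ((Σ k : Fin (m + 1), A k.succ) ⊕ (Σ k : Fin m, B k.succ)))
          (fun b => .inl (.inr (.inr b))) (fun k b => .inr (.inr ⟨k, b⟩)) s.1 s.2))

/-- Right-to-left sweep, the mirror image of `sweepRight`. -/
def sweepLeft {V : Type} : (m : ℕ) → (A : Fin (m + 1) → Type) → (B : Fin m → Type) →
    Prog V (A (Fin.last m)) → (∀ k : Fin m, Prog (V ⊕ A k.succ) (A k.castSucc ⊕ B k)) →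
    Prog V ((Σ k, A k) ⊕ (Σ k, B k))
  | 0, A, _, init, _ =>
      init.outMap (Sum.elim
        (fun s => Fin.cases (motive := fun k => A k → A 0) id (fun k _ => k.elim0) s.1 s.2)
        (fun s => s.1.elim0))
  | m + 1, A, B, init, body =>
      (sweepLeft m (fun k => A k.succ) (fun k => B k.succ) init (fun k => body k.succ)).bind <|
      ((body 0).rename (Sum.map id (fun a => .inl ⟨0, a⟩))).bind <|
      ret (Sum.elim
        (fun s => Fin.cases (motive := fun k => A k →
            (V ⊕ ((Σ k : Fin (m + 1), A k.succ) ⊕ (Σ k : Fin m, B k.succ))) ⊕ (A 0 ⊕ B 0))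
          (fun a => .inr (.inl a)) (fun k a => .inl (.inr (.inl ⟨k, a⟩))) s.1 s.2)
        (fun s => Fin.cases (motive := fun k => B k →
            (V ⊕ ((Σ k : Fin (m + 1), A k.succ) ⊕ (Σ k : Fin m, B k.succ))) ⊕ (A 0 ⊕ B 0))
          (fun b => .inr (.inr b)) (fun k b => .inl (.inr (.inr ⟨k, b⟩))) s.1 s.2))

/-! #### QR decomposition -/

/-- Gram–Schmidt step `j` for the columns of a matrix `A` (variables `inl`): the array `Q`
(variables `inr`) holds the orthonormalized columns `0, …, j - 1` and zero columns. -/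
def gramSchmidtStep {ι : Type} [Fintype ι] {c : ℕ} (j : Fin c) :
    Prog ((ι × Fin c) ⊕ (ι × Fin c)) (ι × Fin c) :=
  (vec (fun i : Fin c => dot (fun x : ι => .inr (x, i)) (fun x => .inl (x, j)))).bind <|
  (vec (fun x : ι =>
    (dot (fun i : Fin c => .inl (.inr (x, i))) (fun i => .inr i)).bind <|
    op (.sub (.inl (.inl (.inl (x, j)))) (.inr ())))).bind <|
  ((dot (fun x : ι => .inr x) (fun x => .inr x)).bind (op (.sqrt (.inr ())))).bind <|
  (vec (fun x : ι => op (.div (.inl (.inr x)) (.inr ())))).bind <|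
  ret (fun xi => if xi.2 = j then .inr xi.1 else .inl (.inl (.inl (.inl (.inr xi)))))

/-- QR decomposition of a matrix `A` with linearly independent columns: `Q` by Gram–Schmidt
(results `inr`), and `R = Qᵀ A` (results `inl`). -/
def qr (ι : Type) [Fintype ι] (c : ℕ) :
    Prog (ι × Fin c) ((Fin c × Fin c) ⊕ (ι × Fin c)) :=
  ((step (.const 0) (ret (fun _ => none)) : Prog (ι × Fin c) (ι × Fin c)).bind
    (loop c gramSchmidtStep)).bind <|
  (vec (fun b : Fin c × Fin c => dot (fun x : ι => .inr (x, b.1)) (fun x => .inl (x, b.2)))).bind <|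
  ret (Sum.elim .inr (fun x => .inl (.inr x)))

end Prog

/-! ### Tensor trains -/

/-- Tensors of size `n 0 × … × n (d - 1)` with the Euclidean (Frobenius) inner product. -/
abbrev Tensor {d : ℕ} (n : Fin d → ℕ) : Type :=
  EuclideanSpace ℝ (∀ k, Fin (n k))

/-- Entries of a family of arrays of sizes `r k × n k × r (k + 1)`, `k = 0, …, d - 1`. -/
abbrev CoreIdx {d : ℕ} (n : Fin d → ℕ) (r : Fin (d + 1) → ℕ) : Type :=
  Σ k : Fin d, Fin (r k.castSucc) × Fin (n k) × Fin (r k.succ)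

/-- Rank vectors `(r 0, …, r d)` with `r 0 = r d = 1` and positive entries. -/
def IsRankVector {d : ℕ} (r : Fin (d + 1) → ℕ) : Prop :=
  r 0 = 1 ∧ r (Fin.last d) = 1 ∧ ∀ k, 1 ≤ r k

/-- The tensor with TT-cores `G`: its entry at `i` is the product of the matrices
`G 0 [i 0] * … * G (d - 1) [i (d - 1)]`, written as a sum over the indices `α` on the bonds. -/
def tt {d : ℕ} {n : Fin d → ℕ} {r : Fin (d + 1) → ℕ} (G : CoreIdx n r → ℝ) : Tensor n :=
  WithLp.toLp 2 fun i => ∑ α : ∀ k, Fin (r k), ∏ k : Fin d, G ⟨k, α k.castSucc, i k, α k.succ⟩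

/-- The unfolding of `X` with the first `k` modes as rows and the other modes as columns. -/
def unfolding {d : ℕ} {n : Fin d → ℕ} (X : Tensor n) (k : ℕ) :
    Matrix (∀ j : {j : Fin d // j.val < k}, Fin (n j)) (∀ j : {j : Fin d // ¬ j.val < k}, Fin (n j))
      ℝ :=
  Matrix.of fun a b => X fun j => if h : j.val < k then a ⟨j, h⟩ else b ⟨j, h⟩

/-- The set of tensors of TT-rank `r`. -/
def ttManifold {d : ℕ} (n : Fin d → ℕ) (r : Fin (d + 1) → ℕ) : Set (Tensor n) :=
  {X | ∀ k : Fin (d + 1), k ≠ 0 → k ≠ Fin.last d → (unfolding X k.val).rank = r k}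

/-- The cores `U 0, …, U (μ - 1), S μ, V (μ + 1), …, V (d - 1)`. -/
def mix {d : ℕ} {n : Fin d → ℕ} {r : Fin (d + 1) → ℕ} (U S V : CoreIdx n r → ℝ) (μ : Fin d) :
    CoreIdx n r → ℝ :=
  fun x => if x.1 < μ then U x else if x.1 = μ then S x else V x

/-- Core `k` is left-orthogonal: `∑ i, U k [i]ᵀ * U k [i] = 1`. -/
def LeftOrthogonal {d : ℕ} {n : Fin d → ℕ} {r : Fin (d + 1) → ℕ} (U : CoreIdx n r → ℝ)
    (k : Fin d) : Prop :=
  ∀ b b' : Fin (r k.succ), ∑ i, ∑ a, U ⟨k, a, i, b⟩ * U ⟨k, a, i, b'⟩ = if b = b' then 1 else 0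

/-- Core `k` is right-orthogonal: `∑ i, V k [i] * V k [i]ᵀ = 1`. -/
def RightOrthogonal {d : ℕ} {n : Fin d → ℕ} {r : Fin (d + 1) → ℕ} (V : CoreIdx n r → ℝ)
    (k : Fin d) : Prop :=
  ∀ a a' : Fin (r k.castSucc), ∑ i, ∑ b, V ⟨k, a, i, b⟩ * V ⟨k, a', i, b⟩ = if a = a' then 1 else 0

/-- `U 0, …, U (d - 2)` are left-orthogonal, `V 1, …, V (d - 1)` are right-orthogonal, and
`X = U 0 ⋯ U (μ - 1) S μ V (μ + 1) ⋯ V (d - 1)` for every `μ`. (`U (d - 1)`, `V 0` are unused.) -/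
structure IsOrthogonalization {d : ℕ} {n : Fin d → ℕ} {r : Fin (d + 1) → ℕ} (X : Tensor n)
    (U S V : CoreIdx n r → ℝ) : Prop where
  left : ∀ k : Fin d, k.val + 1 < d → LeftOrthogonal U k
  right : ∀ k : Fin d, 0 < k.val → RightOrthogonal V k
  eq : ∀ μ : Fin d, tt (mix U S V μ) = X

/-- The tangent vector `∑ k, U 0 ⋯ U (k - 1) δ k V (k + 1) ⋯ V (d - 1)` with delta terms `δ`. -/
def tangentVector {d : ℕ} {n : Fin d → ℕ} {r : Fin (d + 1) → ℕ} (U V δ : CoreIdx n r → ℝ) :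
    Tensor n :=
  ∑ k : Fin d, tt (mix U δ V k)

/-- The tangent space at `X` to the manifold of tensors of TT-rank `r`. (For `X` on the manifold,
all orthogonalizations of `X` give the same vectors.) -/
def tangentSpace {d : ℕ} {n : Fin d → ℕ} (r : Fin (d + 1) → ℕ) (X : Tensor n) :
    Submodule ℝ (Tensor n) :=
  Submodule.span ℝ {T | ∃ U S V : CoreIdx n r → ℝ, IsOrthogonalization X U S V ∧
    ∃ δ : CoreIdx n r → ℝ, tangentVector U V δ = T}

/-- Gauge conditions `∑ i, U k [i]ᵀ * δ k [i] = 0` for `k = 0, …, d - 2`. -/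
def Gauge {d : ℕ} {n : Fin d → ℕ} {r : Fin (d + 1) → ℕ} (U δ : CoreIdx n r → ℝ) : Prop :=
  ∀ k : Fin d, k.val + 1 < d → ∀ b b' : Fin (r k.succ),
    ∑ i, ∑ a, U ⟨k, a, i, b⟩ * δ ⟨k, a, i, b'⟩ = 0

/-- The ranks `(1, 2 r 1, …, 2 r (d - 1), 1)`. -/
def doubleRank {d : ℕ} (r : Fin (d + 1) → ℕ) (k : Fin (d + 1)) : ℕ :=
  if k = 0 ∨ k = Fin.last d then r k else 2 * r k

/-- Position of an index of a doubled bond in the `2 × 2` block structure: first (`inl`) or second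
(`inr`) block. Of the first core only the second block row is present, of the last core only the
first block column. -/
def block {d : ℕ} (r : Fin (d + 1) → ℕ) (k : Fin (d + 1)) (a : Fin (doubleRank r k)) :
    Fin (r k) ⊕ Fin (r k) :=
  if h0 : k = 0 then .inr ⟨a, by have := a.2; simp [doubleRank, h0] at this ⊢; omega⟩
  else if h1 : k = Fin.last d then .inl ⟨a, by have := a.2; simp [doubleRank, h1] at this ⊢; omega⟩
  else if h : a.val < r k then .inl ⟨a, h⟩
  else .inr ⟨a.val - r k, by have := a.2; simp [doubleRank, h0, h1] at this; omega⟩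

/-! ### The algorithm -/

/-- Variables holding the orthogonalized cores. -/
inductive OrthVar (I : Type) : Type
  | U (x : I)
  | S (x : I)
  | V (x : I)

/-- Variables of the auxiliary function `g`. -/
inductive GVar (I : Type) : Type
  | R (x : I)
  | U (x : I)
  | V (x : I)

/-- Variables of the auxiliary function `w`. -/
inductive WVar (I : Type) : Type
  | R (x : I)
  | U (x : I)
  | V (x : I)
  | Z (x : I)

/-- Inputs of the algorithm: the TT-cores `G` of `X` and the delta terms `Z`. -/
inductive HessVar (I : Type) : Type
  | G (x : I)
  | Z (x : I)

section Algorithm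

variable {d : ℕ} (n : Fin d → ℕ) (r : Fin (d + 1) → ℕ)

/-- The identity matrix on bond `k`. -/
def idMatrix (V : Type) (k : Fin (d + 1)) : Prog V (Fin (r k) × Fin (r k)) :=
  .step (.const 0) <| .step (.const 1) <| .ret (fun b => if b.1 = b.2 then none else some none)

/-- Left-to-right orthogonalization: with `C = R k * G k`, the QR decomposition of the left
unfolding of `C` gives the core `U k` and the next factor `R (k + 1)`, for `k = 0, …, d - 2`. -/
def leftBody (k : Fin d) :
    Prog (CoreIdx n r ⊕ (Fin (r k.castSucc) × Fin (r k.castSucc)))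
      ((Fin (r k.succ) × Fin (r k.succ)) ⊕ (Fin (r k.castSucc) × Fin (n k) × Fin (r k.succ))) :=
  (Prog.vec (fun x : Fin (r k.castSucc) × Fin (n k) × Fin (r k.succ) =>
    Prog.dot (fun a' => .inr (x.1, a')) (fun a' => .inl ⟨k, a', x.2.1, x.2.2⟩))).bind <|
  if k.val + 1 < d then
    ((Prog.qr (Fin (r k.castSucc) × Fin (n k)) (r k.succ)).rename
      (fun y => .inr (y.1.1, y.1.2, y.2))).outMap
      (Sum.map id (fun x => ((x.1, x.2.1), x.2.2)))
  else
    (idMatrix r _ k.succ).bind (.ret (Sum.elim .inr (fun x => .inl (.inr x))))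

/-- Right-to-left orthogonalization: with `B = G k * L (k + 1)`, the QR decomposition of the
transposed right unfolding of `B` gives the core `V k` and the next factor `L k`, for
`k = d - 1, …, 1`. -/
def rightBody (k : Fin d) :
    Prog (CoreIdx n r ⊕ (Fin (r k.succ) × Fin (r k.succ)))
      ((Fin (r k.castSucc) × Fin (r k.castSucc)) ⊕
        (Fin (r k.castSucc) × Fin (n k) × Fin (r k.succ))) :=
  (Prog.vec (fun x : Fin (r k.castSucc) × Fin (n k) × Fin (r k.succ) =>
    Prog.dot (fun b' => .inl ⟨k, x.1, x.2.1, b'⟩) (fun b' => .inr (b', x.2.2)))).bind <|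
  if 0 < k.val then
    ((Prog.qr (Fin (n k) × Fin (r k.succ)) (r k.castSucc)).rename
      (fun y => .inr (y.2, y.1.1, y.1.2))).outMap
      (Sum.map Prod.swap (fun x => ((x.2.1, x.2.2), x.1)))
  else
    (idMatrix r _ k.castSucc).bind (.ret (Sum.elim .inr (fun x => .inl (.inr x))))

/-- Orthogonalization of the TT-cores: `U` and the factors `R` from the left-to-right sweep, `V` and
the factors `L` from the right-to-left sweep, and `S k = R k * G k * L (k + 1)`. -/
def orthogonalize : Prog (CoreIdx n r) (OrthVar (CoreIdx n r)) :=
  (Prog.sweepRight d (fun k => Fin (r k) × Fin (r k))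
    (fun k => Fin (r k.castSucc) × Fin (n k) × Fin (r k.succ))
    (idMatrix r _ 0) (leftBody n r)).bind <|
  ((Prog.sweepLeft d (fun k => Fin (r k) × Fin (r k))
    (fun k => Fin (r k.castSucc) × Fin (n k) × Fin (r k.succ))
    (idMatrix r _ (Fin.last d)) (rightBody n r)).rename .inl).bind <|
  (Prog.vec (fun x : CoreIdx n r =>
    Prog.dot (fun a' : Fin (r x.1.castSucc) => .inl (.inr (.inl ⟨x.1.castSucc, x.2.1, a'⟩)))
      (fun a' => .inl (.inl ⟨x.1, a', x.2.2.1, x.2.2.2⟩)))).bind <|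
  (Prog.vec (fun x : CoreIdx n r =>
    Prog.dot (fun b' : Fin (r x.1.succ) => .inr ⟨x.1, x.2.1, x.2.2.1, b'⟩)
      (fun b' => .inl (.inr (.inl ⟨x.1.succ, b', x.2.2.2⟩))))).bind <|
  .ret (fun
    | .U x => .inl (.inl (.inl (.inr (.inr x))))
    | .S x => .inr x
    | .V x => .inl (.inl (.inr (.inr x))))

/-- Conversion of delta terms `R` to the TT-cores `[R 0, U 0]`, `[[V k, 0], [R k, U k]]`,
`[V (d - 1); R (d - 1)]` of the tangent vector. -/
def deltasToCores : Prog (GVar (CoreIdx n r)) (CoreIdx n (doubleRank r)) :=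
  .step (.const 0) <| .ret (fun x =>
    match block r x.1.castSucc x.2.1, block r x.1.succ x.2.2.2 with
    | .inl a, .inl b => some (.V ⟨x.1, a, x.2.2.1, b⟩)
    | .inl _, .inr _ => none
    | .inr a, .inl b => some (.R ⟨x.1, a, x.2.2.1, b⟩)
    | .inr a, .inr b => some (.U ⟨x.1, a, x.2.2.1, b⟩))

/-- The function `g`: the program `p` run on the TT-cores of the tangent vector. -/
def gProg (p : Prog (CoreIdx n (doubleRank r)) Unit) : Prog (GVar (CoreIdx n r)) Unit :=
  (deltasToCores n r).bind (p.rename .inr)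

/-- Enforcing the gauge conditions: `D k := D k - U k * (U kᵀ * D k)` for `k = 0, …, d - 2`, with
the left unfoldings of `D` (variables `inl`) and `U` (variables `inr`). -/
def gaugeProg : Prog (CoreIdx n r ⊕ CoreIdx n r) (CoreIdx n r) :=
  (Prog.vec (fun m : Σ k : Fin d, Fin (r k.succ) × Fin (r k.succ) =>
    if m.1.val + 1 < d then
      Prog.dot (fun y : Fin (r m.1.castSucc) × Fin (n m.1) => .inr ⟨m.1, y.1, y.2, m.2.1⟩)
        (fun y => .inl ⟨m.1, y.1, y.2, m.2.2⟩)
    else Prog.op (.const 0))).bind <|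
  Prog.vec (fun x : CoreIdx n r =>
    if x.1.val + 1 < d then
      (Prog.dot (fun b : Fin (r x.1.succ) => .inl (.inr ⟨x.1, x.2.1, x.2.2.1, b⟩))
        (fun b => .inr ⟨x.1, b, x.2.2.2⟩)).bind <|
      Prog.op (.sub (.inl (.inl (.inl x))) (.inr ()))
    else .ret (fun _ => .inl (.inl x)))

/-- The function `w`: differentiate `g` with respect to `R` (not with respect to `U` and `V`),
enforce the gauge conditions, and take the scalar product with the delta terms `Z`. -/
def wProg (p : Prog (CoreIdx n (doubleRank r)) Unit) : Prog (WVar (CoreIdx n r)) Unit :=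
  (((gProg n r p).grad.outMap .R).rename
    (fun
      | .R x => .R x
      | .U x => .U x
      | .V x => .V x)).bind <|
  ((gaugeProg n r).rename (Sum.elim .inr (fun x => .inl (.U x)))).bind <|
  Prog.dot (fun x : CoreIdx n r => .inr x) (fun x => .inl (.inl (.Z x)))

/-- The approximate Riemannian Hessian-by-vector product: orthogonalize; differentiate `w` with
respect to `R` at `R = (S 0, 0, …, 0)`; enforce the gauge conditions; convert to TT-cores. -/
def hessProg (p : Prog (CoreIdx n (doubleRank r)) Unit) :
    Prog (HessVar (CoreIdx n r)) (CoreIdx n (doubleRank r)) :=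
  ((orthogonalize n r).rename .G).bind <|
  (Prog.step (.const 0) (.ret (fun x : CoreIdx n r =>
    if x.1.val = 0 then some (.inr (.S x)) else none))).bind <|
  (((wProg n r p).grad.outMap .R).rename
    (fun
      | .R x => .inr x
      | .U x => .inl (.inr (.U x))
      | .V x => .inl (.inr (.V x))
      | .Z x => .inl (.inl (.Z x)))).bind <|
  ((gaugeProg n r).rename
    (Sum.elim .inr (fun x => .inl (.inl (.inr (.U x)))))).bind <|
  (deltasToCores n r).rename
    (fun
      | .R x => .inr x
      | .U x => .inl (.inl (.inl (.inr (.U x))))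
      | .V x => .inl (.inl (.inl (.inr (.V x)))))

end Algorithm

/-! ### Sizes and costs -/

/-- `n = max n k`. -/
def maxMode {d : ℕ} (n : Fin d → ℕ) : ℕ :=
  Finset.univ.sup n

/-- `r = max r k` over the inner bonds `k = 1, …, d - 1`. -/
def maxRank {d : ℕ} (r : Fin (d + 1) → ℕ) : ℕ :=
  (Finset.univ.filter (fun k => k ≠ 0 ∧ k ≠ Fin.last d)).sup r

/-- `F` is polynomial in the ranks: up to the constant factor `K` it equals a polynomial of total
degree at most `q` with nonnegative coefficients. -/
def PolynomialInRanks {d : ℕ} (q : ℕ) (K : ℝ) (F : (Fin (d + 1) → ℕ) → ℝ) : Prop :=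
  ∃ P : MvPolynomial (Fin (d + 1)) ℝ, P.totalDegree ≤ q ∧ (∀ m, 0 ≤ P.coeff m) ∧
    ∀ r, IsRankVector r →
      MvPolynomial.eval (fun k => (r k : ℝ)) P ≤ F r ∧
      F r ≤ K * MvPolynomial.eval (fun k => (r k : ℝ)) P

/-- The programs `p r` evaluate `f` at the tensors of `D` from TT-cores of any ranks `r`. -/
def Evaluates {d : ℕ} {n : Fin d → ℕ} (p : ∀ r : Fin (d + 1) → ℕ, Prog (CoreIdx n r) Unit)
    (f : Tensor n → ℝ) (D : Set (Tensor n)) : Prop :=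
  ∀ r, IsRankVector r → ∀ G : CoreIdx n r → ℝ, tt G ∈ D →
    (p r).Regular G ∧ (p r).eval G () = f (tt G)

/-- Assignments of values to the variables of `w` and to the inputs of the algorithm. -/
def WVar.values {I : Type} (R U V Z : I → ℝ) : WVar I → ℝ
  | .R x => R x
  | .U x => U x
  | .V x => V x
  | .Z x => Z x

def HessVar.values {I : Type} (G Z : I → ℝ) : HessVar I → ℝ
  | .G x => G x
  | .Z x => Z x

end

end TTAD

open TTAD

namespace TTAD

noncomputable section

/-! ### Compositional semantics of programs: value, regularity and cost of subroutine calls and of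
sequencing. -/

namespace Op

variable {V W : Type}

/-! Fix an orthogonalization `U, S, V` of `X` and let `T = tangentVector U V`, a linear map from
delta terms to tensors. Two facts about `T` carry the correctness. Every vector in its range has
delta terms satisfying the gauge conditions (`exists_gauge`), and on such delta terms `T` is an
isometry (`inner_tangentVector`). Hence the orthogonal projection onto the range of `T` is obtained
by applying the adjoint `T*`, removing the components along the `U k`, and applying `T`
(`starProjection_eq_tangentVector`).

The block cores represent `T R`, so `g R = f (T R)`, and its gradient in `R` is `T* ∇f(T R)`.
Pairing the gauge-projected gradient with gauged delta terms of `Z` gives `w R = ⟨∇f(T R), Z⟩`,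
which equals `⟨P ∇f(T R), Z⟩` because `Z` is tangent. Differentiating once more in the direction `H`
gives `⟨∇²f(T R) (T H), Z⟩ = ⟨∇²f(T R) Z, T H⟩` by symmetry of the second derivative. So the
gradient of `w` is `T* (∇²f(T R) Z)`. The choice `R = (S 0, 0, …, 0)` makes `T R = X`, and the same
projection recipe turns this gradient into `P ∇²f(X) Z`.

Backpropagation is needed only to first order (`Prog.hasDerivAt_eval`): the program `w`, although it
contains a reverse pass, is an ordinary program, and near the point in question it agrees along each
line with a known differentiable function. Uniqueness of derivatives then identifies what its
reverse pass computes.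

Two rank arguments connect this with the manifold. Full rank of the unfoldings makes the interface
matrices injective, so each QR decomposition meets linearly independent columns and the sweeps are
well defined (`orthogonalize_spec`). It also forces any two decompositions of `X` to have interfaces
with the same ranges, so the tangent space, defined through all orthogonalizations, is the range of
the single map `T` (`tangentSpace_eq_range`).

For the cost, a gradient takes at most six times the FLOP of its program, so two nested gradients
give the factor 36. Doubling the ranks multiplies a cost polynomial of degree at most `q` by at most
`|K| * 2 ^ q`, and everything else is `O(d n r³)`. -/

theorem eval_rename (o : Op V) (φ : V → W) (x : W → ℝ) :
    (o.rename φ).eval x = o.eval (x ∘ φ) := by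
  cases o <;> rfl

theorem regular_rename (o : Op V) (φ : V → W) (x : W → ℝ) :
    (o.rename φ).Regular x ↔ o.Regular (x ∘ φ) := by
  cases o <;> rfl

theorem cost_rename (o : Op V) (φ : V → W) : (o.rename φ).cost = o.cost := by
  cases o <;> rfl

end Op

namespace Prog

theorem elim_comp_map {V W : Type} (φ : V → W) (c : ℝ) (x : W → ℝ) :
    (fun v : Option W => v.elim c x) ∘ Option.map φ = fun v => v.elim c (x ∘ φ) := by
  funext v
  cases v <;> rfl

theorem eval_rename {V O W : Type} (p : Prog V O) (φ : V → W) (x : W → ℝ) :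
    (p.rename φ).eval x = p.eval (x ∘ φ) := by
  induction p generalizing W with
  | ret out => rfl
  | step o rest ih =>
    simp only [rename, eval]
    rw [ih, Op.eval_rename, elim_comp_map]

theorem regular_rename {V O W : Type} (p : Prog V O) (φ : V → W) (x : W → ℝ) :
    (p.rename φ).Regular x ↔ p.Regular (x ∘ φ) := by
  induction p generalizing W with
  | ret out => rfl
  | step o rest ih =>
    simp only [rename, Regular]
    rw [ih, Op.eval_rename, Op.regular_rename, elim_comp_map]

theorem cost_rename {V O W : Type} (p : Prog V O) (φ : V → W) :
    (p.rename φ).cost = p.cost := by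
  induction p generalizing W with
  | ret out => rfl
  | step o rest ih => simp only [rename, cost, ih, Op.cost_rename]

theorem elim_comp_sumMap {V O : Type} (c : ℝ) (x : V → ℝ) (y : O → ℝ) :
    (Sum.elim (fun v : Option V => v.elim c x) y) ∘ Sum.map some id = Sum.elim x y := by
  funext v
  cases v <;> rfl

theorem eval_bind {V O P : Type} (p : Prog V O) (q : Prog (V ⊕ O) P) (x : V → ℝ) :
    (p.bind q).eval x = q.eval (Sum.elim x (p.eval x)) := by
  induction p with
  | ret out =>
    simp only [bind, eval, eval_rename]
    congr 1
    funext v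
    cases v <;> rfl
  | step o rest ih =>
    simp only [bind, eval]
    rw [ih, eval_rename, elim_comp_sumMap]

theorem regular_bind {V O P : Type} (p : Prog V O) (q : Prog (V ⊕ O) P) (x : V → ℝ) :
    (p.bind q).Regular x ↔ p.Regular x ∧ q.Regular (Sum.elim x (p.eval x)) := by
  induction p with
  | ret out =>
    simp only [bind, eval, regular_rename, Regular, true_and]
    rw [show x ∘ Sum.elim id out = Sum.elim x (fun o => x (out o)) by funext v; cases v <;> rfl]
  | step o rest ih =>
    simp only [bind, eval, Regular]
    rw [ih, regular_rename, elim_comp_sumMap, and_assoc]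

theorem cost_bind {V O P : Type} (p : Prog V O) (q : Prog (V ⊕ O) P) :
    (p.bind q).cost = p.cost + q.cost := by
  induction p with
  | ret out => simp only [bind, cost, cost_rename, zero_add]
  | step o rest ih => simp only [bind, cost, ih, cost_rename, add_assoc]

theorem eval_ret {V O : Type} (out : O → V) (x : V → ℝ) (o : O) :
    (ret out).eval x o = x (out o) := rfl

theorem eval_op {V : Type} (o : Op V) (x : V → ℝ) (u : Unit) : (op o).eval x u = o.eval x := rfl

theorem regular_op {V : Type} (o : Op V) (x : V → ℝ) : (op o).Regular x ↔ o.Regular x := by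
  simp [op, Regular]

theorem cost_op {V : Type} (o : Op V) : (op o).cost = o.cost := rfl

theorem regular_ret {V O : Type} (out : O → V) (x : V → ℝ) : (ret out).Regular x := trivial

theorem cost_ret {V O : Type} (out : O → V) : (ret out).cost = 0 := rfl

theorem eval_outMap {V O P : Type} (p : Prog V O) (φ : P → O) (x : V → ℝ) :
    (p.outMap φ).eval x = p.eval x ∘ φ := by
  rw [outMap, eval_bind]
  rfl

theorem regular_outMap {V O P : Type} (p : Prog V O) (φ : P → O) (x : V → ℝ) :
    (p.outMap φ).Regular x ↔ p.Regular x := by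
  simp [outMap, regular_bind, Regular]

theorem cost_outMap {V O P : Type} (p : Prog V O) (φ : P → O) : (p.outMap φ).cost = p.cost := by
  simp [outMap, cost_bind, cost]

/-! ### Arrays and dot products -/

theorem eval_vecFin {V : Type} (m : ℕ) (p : Fin m → Prog V Unit) (x : V → ℝ) (i : Fin m) :
    (vecFin m p).eval x i = (p i).eval x () := by
  induction m with
  | zero => exact i.elim0
  | succ m ih =>
    simp only [vecFin, eval_bind, eval, eval_rename]
    cases i using Fin.cases with
    | zero => rfl
    | succ j => exact ih (fun i => p i.succ) j

theorem regular_vecFin {V : Type} (m : ℕ) (p : Fin m → Prog V Unit) (x : V → ℝ) :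
    (vecFin m p).Regular x ↔ ∀ i, (p i).Regular x := by
  induction m with
  | zero => simp [vecFin, Regular]
  | succ m ih =>
    simp only [vecFin, regular_bind, regular_rename, Regular, and_true, Fin.forall_fin_succ]
    exact and_congr_right fun _ => ih (fun i => p i.succ)

theorem cost_vecFin {V : Type} (m : ℕ) (p : Fin m → Prog V Unit) :
    (vecFin m p).cost = ∑ i, (p i).cost := by
  induction m with
  | zero => simp [vecFin, cost]
  | succ m ih =>
    simp only [vecFin, cost_bind, cost_rename, cost, Fin.sum_univ_succ, ih, add_zero]

theorem eval_vec {V ι : Type} [Fintype ι] (p : ι → Prog V Unit) (x : V → ℝ) (i : ι) :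
    (vec p).eval x i = (p i).eval x () := by
  simp [vec, eval_outMap, eval_vecFin]

theorem regular_vec {V ι : Type} [Fintype ι] (p : ι → Prog V Unit) (x : V → ℝ) :
    (vec p).Regular x ↔ ∀ i, (p i).Regular x := by
  rw [vec, regular_outMap, regular_vecFin]
  exact (Fintype.equivFin ι).symm.forall_congr_right (q := fun i => (p i).Regular x)

theorem cost_vec {V ι : Type} [Fintype ι] (p : ι → Prog V Unit) :
    (vec p).cost = ∑ i, (p i).cost := by
  rw [vec, cost_outMap, cost_vecFin]
  exact Equiv.sum_comp (Fintype.equivFin ι).symm fun i => (p i).cost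

theorem eval_dotFin {V : Type} (m : ℕ) (a b : Fin m → V) (x : V → ℝ) (u : Unit) :
    (dotFin m a b).eval x u = ∑ i, x (a i) * x (b i) := by
  induction m with
  | zero => simp [dotFin, eval_op, Op.eval]
  | succ m ih =>
    simp [dotFin, eval_bind, eval, ih, eval_op, Op.eval, Fin.sum_univ_succ, add_comm]

theorem regular_dotFin {V : Type} (m : ℕ) (a b : Fin m → V) (x : V → ℝ) :
    (dotFin m a b).Regular x := by
  induction m with
  | zero => simp [dotFin, regular_op, Op.Regular]
  | succ m ih => simp [dotFin, regular_bind, Regular, ih, regular_op, Op.Regular]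

theorem cost_dotFin {V : Type} (m : ℕ) (a b : Fin m → V) : (dotFin m a b).cost = 2 * m := by
  induction m with
  | zero => rfl
  | succ m ih =>
    simp only [dotFin, cost_bind, cost, ih, cost_op, Op.cost]
    ring

theorem eval_dot {V ι : Type} [Fintype ι] (a b : ι → V) (x : V → ℝ) (u : Unit) :
    (dot a b).eval x u = ∑ i, x (a i) * x (b i) := by
  rw [dot, eval_dotFin]
  exact Equiv.sum_comp (Fintype.equivFin ι).symm fun i => x (a i) * x (b i)

theorem regular_dot {V ι : Type} [Fintype ι] (a b : ι → V) (x : V → ℝ) :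
    (dot a b).Regular x :=
  regular_dotFin _ _ _ _

theorem cost_dot {V ι : Type} [Fintype ι] (a b : ι → V) :
    (dot a b).cost = 2 * Fintype.card ι :=
  cost_dotFin _ _ _

/-! ### Loops and sweeps -/

/-- Hoare rule for `loop`: an invariant that every iteration preserves holds at the end, and all
operations are regular. -/
theorem loop_invariant {V S : Type} (x : V → ℝ) (m : ℕ) (body : Fin m → Prog (V ⊕ S) S)
    (I : ℕ → (S → ℝ) → Prop)
    (hI : ∀ k : Fin m, ∀ s, I k s → (body k).Regular (Sum.elim x s) ∧
      I (k + 1) ((body k).eval (Sum.elim x s)))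
    (s : S → ℝ) (hs : I 0 s) :
    (loop m body).Regular (Sum.elim x s) ∧ I m ((loop m body).eval (Sum.elim x s)) := by
  induction m generalizing s I with
  | zero => exact ⟨trivial, hs⟩
  | succ m ih =>
    have h0 := hI 0 s hs
    have h := ih (fun i => body i.succ) (fun k => I (k + 1))
      (fun k s hk => hI k.succ s hk) _ h0.2
    have e : Sum.elim (Sum.elim x s) ((body 0).eval (Sum.elim x s)) ∘ Sum.map Sum.inl id =
        Sum.elim x ((body 0).eval (Sum.elim x s)) := by
      funext v
      cases v <;> rfl
    simp only [loop, regular_bind, regular_rename, eval_bind, eval_rename, e]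
    exact ⟨⟨h0.1, h.1⟩, h.2⟩

theorem cost_loop {V S : Type} (m : ℕ) (body : Fin m → Prog (V ⊕ S) S) :
    (loop m body).cost = ∑ k, (body k).cost := by
  induction m with
  | zero => simp [loop, cost]
  | succ m ih => simp only [loop, cost_bind, cost_rename, ih, Fin.sum_univ_succ]

/-- Unfolding of `sweepRight`, with all types indexed by `Fin.castSucc 0` instead of `0`. -/
theorem sweepRight_succ {V : Type} (m : ℕ) (A : Fin (m + 2) → Type) (B : Fin (m + 1) → Type)
    (init : Prog V (A (Fin.castSucc 0)))
    (body : ∀ k : Fin (m + 1), Prog (V ⊕ A k.castSucc) (A k.succ ⊕ B k)) :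
    ∃ out : ((Σ k, A k) ⊕ (Σ k, B k)) → ((V ⊕ A (Fin.castSucc 0)) ⊕ (A (Fin.succ 0) ⊕ B 0)) ⊕
        ((Σ k : Fin (m + 1), A k.succ) ⊕ (Σ k : Fin m, B k.succ)),
      sweepRight (m + 1) A B init body = init.bind ((body 0).bind
        ((sweepRight m (fun k => A k.succ) (fun k => B k.succ) (ret (fun a => .inr (.inl a)))
          (fun k => (body k.succ).rename (Sum.map (fun v => .inl (.inl v)) id))).bind
          (ret out))) ∧
      (∀ a, out (.inl ⟨0, a⟩) = .inl (.inl (.inr a))) ∧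
      (∀ k a, out (.inl ⟨Fin.succ k, a⟩) = .inr (.inl ⟨k, a⟩)) ∧
      (∀ b, out (.inr ⟨0, b⟩) = .inl (.inr (.inr b))) ∧
      (∀ k b, out (.inr ⟨Fin.succ k, b⟩) = .inr (.inr ⟨k, b⟩)) :=
  ⟨_, rfl, fun _ => rfl, fun _ _ => rfl, fun _ => rfl, fun _ _ => rfl⟩

/-- The sweep is described by all its intermediate states and outputs, linked by one equation per
position. Regularity is a conditional conclusion: that a body is regular at the state reached
depends on invariants that users derive from these equations. -/
theorem sweepRight_spec {V : Type} (x : V → ℝ) (m : ℕ) (A : Fin (m + 1) → Type) (B : Fin m → Type)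
    (init : Prog V (A 0))
    (body : ∀ k : Fin m, Prog (V ⊕ A k.castSucc) (A k.succ ⊕ B k)) :
    ∃ (a : ∀ k, A k → ℝ) (b : ∀ k, B k → ℝ),
      (sweepRight m A B init body).eval x = Sum.elim (fun s => a s.1 s.2) (fun s => b s.1 s.2) ∧
      a 0 = init.eval x ∧
      (∀ k, (body k).eval (Sum.elim x (a k.castSucc)) = Sum.elim (a k.succ) (b k)) ∧
      (init.Regular x → (∀ k, (body k).Regular (Sum.elim x (a k.castSucc))) →
        (sweepRight m A B init body).Regular x) := by
  induction m generalizing V with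
  | zero =>
    refine ⟨fun k => Fin.cases (motive := fun k => A k → ℝ) (init.eval x) (fun k => k.elim0) k,
      fun k => k.elim0, ?_, rfl, fun k => k.elim0, fun h _ => ?_⟩
    · funext s
      rcases s with ⟨k, a⟩ | ⟨k, b⟩
      · simp only [sweepRight, eval_outMap]
        obtain rfl : k = 0 := Subsingleton.elim (α := Fin 1) _ _
        rfl
      · exact k.elim0
    · rwa [sweepRight, regular_outMap]
  | succ m ih =>
    obtain ⟨out, hs, ho1, ho2, ho3, ho4⟩ := sweepRight_succ m A B init body
    change Prog V (A (Fin.castSucc 0)) at init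
    -- The recursive sweep runs with the initial state and the first result also in scope, hence the
    -- induction over all variable types. By `e` below, the renamed bodies see only `x` and the
    -- current state.
    have key := ih (Sum.elim (Sum.elim x (init.eval x))
        ((body 0).eval (Sum.elim x (init.eval x)))) (fun k => A k.succ) (fun k => B k.succ)
        (ret (fun a => .inr (.inl a)))
        (fun k => (body k.succ).rename (Sum.map (fun v => .inl (.inl v)) id))
    have e : ∀ k (y : A k → ℝ), Sum.elim (Sum.elim (Sum.elim x (init.eval x))
        ((body 0).eval (Sum.elim x (init.eval x)))) y ∘ Sum.map (fun v => .inl (.inl v)) id =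
        Sum.elim x y := by
      intro k y
      funext v
      cases v <;> rfl
    simp only [eval_rename, regular_rename] at key
    obtain ⟨a, b, h, ha, hab, hr⟩ := key
    have h00 : (body 0).eval (Sum.elim x (init.eval x)) = Sum.elim (a 0)
        (fun z => (body 0).eval (Sum.elim x (init.eval x)) (.inr z)) := by
      rw [ha]
      funext v
      cases v <;> rfl
    rw [hs]
    refine ⟨fun k => Fin.cases (motive := fun k => A k → ℝ) (init.eval x) a k,
      fun k => Fin.cases (motive := fun k => B k → ℝ)
        (fun z => (body 0).eval (Sum.elim x (init.eval x)) (.inr z)) b k, ?_, rfl, ?_, ?_⟩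
    · rw [eval_bind, eval_bind, eval_bind, h]
      funext s
      rw [eval_ret]
      rcases s with ⟨k, z⟩ | ⟨k, z⟩
      · cases k using Fin.cases with
        | zero => rw [ho1]; rfl
        | succ k => rw [ho2]; rfl
      · cases k using Fin.cases with
        | zero => rw [ho3]; rfl
        | succ k => rw [ho4]; rfl
    · intro k
      cases k using Fin.cases with
      | zero => exact h00
      | succ k =>
        have := hab k
        rw [e k.castSucc.succ] at this
        exact this
    · intro hi hb
      rw [regular_bind, regular_bind, regular_bind]
      refine ⟨hi, hb 0, hr trivial fun k => ?_, trivial⟩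
      rw [e k.castSucc.succ]
      exact hb k.succ

theorem cost_sweepRight {V : Type} (m : ℕ) (A : Fin (m + 1) → Type) (B : Fin m → Type)
    (init : Prog V (A 0)) (body : ∀ k : Fin m, Prog (V ⊕ A k.castSucc) (A k.succ ⊕ B k)) :
    (sweepRight m A B init body).cost = init.cost + ∑ k, (body k).cost := by
  induction m generalizing V with
  | zero => simp [sweepRight, cost_outMap]
  | succ m ih =>
    obtain ⟨out, hs, -⟩ := sweepRight_succ m A B init body
    change Prog V (A (Fin.castSucc 0)) at init
    rw [hs, cost_bind, cost_bind, cost_bind, ih, Fin.sum_univ_succ]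
    simp only [cost_rename, cost_ret, zero_add, add_zero]
    rfl

theorem sweepLeft_spec {V : Type} (x : V → ℝ) (m : ℕ) (A : Fin (m + 1) → Type) (B : Fin m → Type)
    (init : Prog V (A (Fin.last m)))
    (body : ∀ k : Fin m, Prog (V ⊕ A k.succ) (A k.castSucc ⊕ B k)) :
    ∃ (a : ∀ k, A k → ℝ) (b : ∀ k, B k → ℝ),
      (sweepLeft m A B init body).eval x = Sum.elim (fun s => a s.1 s.2) (fun s => b s.1 s.2) ∧
      a (Fin.last m) = init.eval x ∧
      (∀ k, (body k).eval (Sum.elim x (a k.succ)) = Sum.elim (a k.castSucc) (b k)) ∧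
      (init.Regular x → (∀ k, (body k).Regular (Sum.elim x (a k.succ))) →
        (sweepLeft m A B init body).Regular x) := by
  induction m with
  | zero =>
    refine ⟨fun k => Fin.cases (motive := fun k => A k → ℝ) (init.eval x) (fun k => k.elim0) k,
      fun k => k.elim0, ?_, rfl, fun k => k.elim0, fun h _ => ?_⟩
    · funext s
      rcases s with ⟨k, a⟩ | ⟨k, b⟩
      · simp only [sweepLeft, eval_outMap]
        obtain rfl : k = 0 := Subsingleton.elim (α := Fin 1) _ _
        rfl
      · exact k.elim0
    · rwa [sweepLeft, regular_outMap]
  | succ m ih =>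
    obtain ⟨a, b, h, ha, hab, hr⟩ := ih (fun k => A k.succ) (fun k => B k.succ) init
      (fun k => body k.succ)
    have e : Sum.elim x ((sweepLeft m (fun k => A k.succ) (fun k => B k.succ) init
        (fun k => body k.succ)).eval x) ∘ Sum.map id (fun a => .inl ⟨0, a⟩) =
        Sum.elim x (a 0) := by
      rw [h]
      funext v
      cases v <;> rfl
    refine ⟨fun k => Fin.cases (motive := fun k => A k → ℝ)
        (fun z => (body 0).eval (Sum.elim x (a 0)) (.inl z)) a k,
      fun k => Fin.cases (motive := fun k => B k → ℝ)
        (fun z => (body 0).eval (Sum.elim x (a 0)) (.inr z)) b k, ?_, ha, ?_, ?_⟩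
    · simp only [sweepLeft, eval_bind, eval_rename]
      rw [e]
      funext s
      rcases s with ⟨k, a⟩ | ⟨k, b⟩
      · cases k using Fin.cases with
        | zero => rfl
        | succ k =>
          simp only [eval_ret]
          exact congrFun h (.inl ⟨k, a⟩)
      · cases k using Fin.cases with
        | zero => rfl
        | succ k =>
          simp only [eval_ret]
          exact congrFun h (.inr ⟨k, b⟩)
    · intro k
      cases k using Fin.cases with
      | zero =>
        funext v
        cases v <;> rfl
      | succ k => exact hab k
    · intro hi hb
      simp only [sweepLeft, regular_bind, regular_rename]
      rw [e]
      exact ⟨hr hi fun k => hb k.succ, hb 0, trivial⟩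

theorem cost_sweepLeft {V : Type} (m : ℕ) (A : Fin (m + 1) → Type) (B : Fin m → Type)
    (init : Prog V (A (Fin.last m)))
    (body : ∀ k : Fin m, Prog (V ⊕ A k.succ) (A k.castSucc ⊕ B k)) :
    (sweepLeft m A B init body).cost = init.cost + ∑ k, (body k).cost := by
  induction m with
  | zero => simp [sweepLeft, cost_outMap]
  | succ m ih =>
    simp only [sweepLeft, cost_bind, ih, cost_ret, Fin.sum_univ_succ, cost_rename]
    ring

end Prog

/-! ### Correctness and cost of reverse-mode differentiation. -/

open Classical in
/-- The partial derivatives of an elementary operation. -/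
def Op.partialDeriv {V : Type} (x : V → ℝ) : Op V → V → ℝ
  | const _ => 0
  | add a b => Pi.single a 1 + Pi.single b 1
  | sub a b => Pi.single a 1 + Pi.single b (-1)
  | mul a b => Pi.single a (x b) + Pi.single b (x a)
  | div a b => Pi.single a (x b)⁻¹ + Pi.single b (-(x a / x b / x b))
  | sqrt a => Pi.single a (1 / (2 * Real.sqrt (x a)))
  | exp a => Pi.single a (Real.exp (x a))
  | log a => Pi.single a (x a)⁻¹
  | sin a => Pi.single a (Real.cos (x a))
  | cos a => Pi.single a (-Real.sin (x a))
  | arctan a => Pi.single a (1 / (1 + x a ^ 2))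

/-- Chain rule for an elementary operation along a curve. -/
theorem Op.hasDerivAt_eval {V : Type} [Fintype V] (o : Op V) (γ : ℝ → V → ℝ) (γ' : V → ℝ) (t : ℝ)
    (hγ : ∀ v, HasDerivAt (fun s => γ s v) (γ' v) t) (ho : o.Regular (γ t)) :
    HasDerivAt (fun s => o.eval (γ s)) (∑ v, o.partialDeriv (γ t) v * γ' v) t := by
  classical
  cases o <;> simp only [Op.eval, Op.partialDeriv, Op.Regular] at ho ⊢ <;>
    simp only [Pi.add_apply, Pi.zero_apply, Pi.single_apply, add_mul, Finset.sum_add_distrib,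
      ite_mul, zero_mul, Finset.sum_ite_eq', Finset.mem_univ, if_true, Finset.sum_const_zero,
      one_mul, neg_mul]
  case const c => exact hasDerivAt_const t c
  case add a b => exact (hγ a).add (hγ b)
  case sub a b => exact ((hγ a).sub (hγ b)).congr_deriv (sub_eq_add_neg _ _)
  case mul a b => exact ((hγ a).mul (hγ b)).congr_deriv (by ring)
  case div a b =>
    refine ((hγ a).div (hγ b) ho).congr_deriv ?_
    field_simp
    ring
  case sqrt a => exact ((hγ a).sqrt ho.ne').congr_deriv (by ring)
  case exp a => exact (hγ a).exp
  case log a => exact ((hγ a).log ho.ne').congr_deriv (by ring)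
  case sin a => exact (hγ a).sin
  case cos a => exact ((hγ a).cos).congr_deriv (by ring)
  case arctan a => exact (hγ a).arctan

namespace Prog

open Classical in
theorem eval_acc {V W : Type} (adj : V → W) (a : V) (c : W) (x : W → ℝ) :
    (acc adj a c).eval x = x ∘ adj + Pi.single a (x c) := by
  funext v
  by_cases h : v = a
  · subst h
    simp [acc, eval, Op.eval]
  · simp [acc, eval, h]

open Classical in
-- The case `a = b` is included, because the second update reads the adjoint already changed by the
-- first. This is what makes operations such as `a * a` differentiate correctly.
theorem eval_acc₂ {V W : Type} (adj : V → W) (a : V) (c : W) (b : V) (e : W) (x : W → ℝ) :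
    (acc₂ adj a c b e).eval x = x ∘ adj + Pi.single a (x c) + Pi.single b (x e) := by
  funext v
  simp only [acc₂, eval, eval_acc, Pi.add_apply, Function.comp]
  by_cases h : v = a
  · subst h
    simp [Op.eval]
  · simp [h]

/-- The reverse step through `y = o` adds `ȳ · ∂y/∂v` to the adjoint of every variable `v`. -/
theorem eval_pullback {V : Type} (o : Op V) (x : V → ℝ) (adj : Option V → ℝ) (v : V) :
    (pullback o).eval (Sum.elim (fun v => v.elim (o.eval x) x) adj) v =
      adj (some v) + adj none * o.partialDeriv x v := by
  classical
  have single (a : V) (c : ℝ) : adj none * (Pi.single a c : V → ℝ) v =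
      (Pi.single a (adj none * c) : V → ℝ) v := by
    simp [Pi.single_apply]
  cases o <;>
    simp [pullback, eval, eval_acc, eval_acc₂, Op.eval, Op.partialDeriv, mul_add, single,
      div_eq_mul_inv, add_assoc, mul_assoc, pow_two, two_mul, -mul_inv_rev]
  case div a b =>
    ring_nf

theorem regular_acc {V W : Type} (adj : V → W) (a : V) (c : W) (x : W → ℝ) :
    (acc adj a c).Regular x :=
  ⟨trivial, trivial⟩

theorem regular_acc₂ {V W : Type} (adj : V → W) (a : V) (c : W) (b : V) (e : W) (x : W → ℝ) :
    (acc₂ adj a c b e).Regular x :=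
  ⟨trivial, trivial, trivial⟩

/-- The reverse step divides only by a denominator of the forward run, by twice a square root, by
the argument of a logarithm, or by `1 + x²`. None of these vanishes where the forward operation is
regular. -/
theorem regular_pullback {V : Type} (o : Op V) (x : V → ℝ) (adj : Option V → ℝ)
    (ho : o.Regular x) :
    (pullback o).Regular (Sum.elim (fun v => v.elim (o.eval x) x) adj) := by
  cases o <;>
    simp [pullback, Regular, regular_acc, regular_acc₂, Op.Regular, Op.eval] at ho ⊢
  case div a b => exact ho
  case sqrt a =>
    have := Real.sqrt_pos.2 ho
    positivity
  case log a => exact ho.ne'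
  case arctan a => nlinarith [mul_self_nonneg (x a)]

/-- The factor 5 is attained by division: two operations for the quotients, one for the sign, two
for the updates. -/
theorem cost_pullback {V : Type} (o : Op V) : (pullback o).cost ≤ 5 * o.cost := by
  cases o <;> simp [pullback, cost, acc, acc₂, Op.cost]

/-- Backpropagation is correct: along every curve of inputs, the derivative of the output is the
scalar product of the computed gradient and the velocity. -/
theorem hasDerivAt_eval : ∀ {V : Type} [Fintype V] (p : Prog V Unit) (γ : ℝ → V → ℝ) (γ' : V → ℝ)
    (t : ℝ), (∀ v, HasDerivAt (fun s => γ s v) (γ' v) t) → p.Regular (γ t) →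
    HasDerivAt (fun s => p.eval (γ s) ()) (∑ v, p.grad.eval (γ t) v * γ' v) t
  | V, _, ret out, γ, γ', t, hγ, _ => by
    refine (hγ (out ())).congr_deriv (Eq.symm ?_)
    rw [Finset.sum_eq_single (out ())]
    · simp [grad, eval, Op.eval]
    · intro v _ hv
      simp [grad, eval, Op.eval, hv]
    · simp
  | V, _, step o rest, γ, γ', t, hγ, hr => by
    -- The curve of inputs is extended by the curve of values of the new variable, whose velocity is
    -- the chain rule for `o`. The reverse step redistributes the adjoint of that variable
    -- accordingly.
    have h := hasDerivAt_eval rest (fun s v => v.elim (o.eval (γ s)) (γ s))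
      (fun v => v.elim (∑ v, o.partialDeriv (γ t) v * γ' v) γ') t
      (by
        rintro (_ | v)
        · exact o.hasDerivAt_eval γ γ' t hγ hr.1
        · exact hγ v) hr.2
    refine h.congr_deriv ?_
    have e v : (step o rest).grad.eval (γ t) v =
        rest.grad.eval (fun v => v.elim (o.eval (γ t)) (γ t)) (some v) +
        rest.grad.eval (fun v => v.elim (o.eval (γ t)) (γ t)) none * o.partialDeriv (γ t) v := by
      rw [grad, eval, eval_bind, eval_pullback]
    simp only [e, Fintype.sum_option, Option.elim_none, Option.elim_some, add_mul,
      Finset.sum_add_distrib, Finset.mul_sum, mul_assoc]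
    rw [add_comm]

theorem regular_grad : ∀ {V : Type} (p : Prog V Unit) (x : V → ℝ), p.Regular x →
    p.grad.Regular x
  | _, ret _, _, _ => by simp [grad, Regular, Op.Regular]
  | _, step o rest, x, h => by
    simp only [grad, Regular, regular_bind]
    exact ⟨h.1, regular_grad rest _ h.2, regular_pullback o x _ h.1⟩

/-- Each operation is executed once forwards and contributes at most five operations backwards.
Initializing the adjoints uses only constants, which are free. -/
theorem cost_grad : ∀ {V : Type} (p : Prog V Unit), p.grad.cost ≤ 6 * p.cost
  | _, ret _ => by simp [grad, cost, Op.cost]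
  | _, step o rest => by
    have h1 := cost_grad rest
    have h2 := cost_pullback o
    simp only [grad, cost, cost_bind]
    omega

end Prog

/-! ### Products of chains of matrices -/

section Chain

variable {d : ℕ} {A : Fin (d + 1) → Type} [∀ k, Fintype (A k)]

/-- The row vector `1ᵀ * M 0 * ⋯ * M (k - 1)`. -/
def chainLeft (M : ∀ k : Fin d, A k.castSucc → A k.succ → ℝ) (k : Fin (d + 1)) : A k → ℝ :=
  Fin.induction (motive := fun k => A k → ℝ) (fun _ => 1) (fun k L b => ∑ a, L a * M k a b) k

/-- The column vector `M k * ⋯ * M (d - 1) * 1`. -/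
def chainRight (M : ∀ k : Fin d, A k.castSucc → A k.succ → ℝ) (k : Fin (d + 1)) : A k → ℝ :=
  Fin.reverseInduction (motive := fun k => A k → ℝ) (fun _ => 1)
    (fun k R a => ∑ b, M k a b * R b) k

variable (M M' : ∀ k : Fin d, A k.castSucc → A k.succ → ℝ)

theorem chainLeft_zero (a : A 0) : chainLeft M 0 a = 1 := rfl

theorem chainLeft_succ (k : Fin d) (b : A k.succ) :
    chainLeft M k.succ b = ∑ a, chainLeft M k.castSucc a * M k a b := by
  rw [chainLeft, Fin.induction_succ]
  rfl

theorem chainRight_last (a : A (Fin.last d)) : chainRight M (Fin.last d) a = 1 := by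
  rw [chainRight, Fin.reverseInduction_last]

theorem chainRight_castSucc (k : Fin d) (a : A k.castSucc) :
    chainRight M k.castSucc a = ∑ b, M k a b * chainRight M k.succ b := by
  rw [chainRight, Fin.reverseInduction_castSucc]
  rfl

variable {M M'} in
theorem chainLeft_congr (k : Fin (d + 1)) (h : ∀ j : Fin d, j.castSucc < k → M j = M' j) :
    chainLeft M k = chainLeft M' k := by
  induction k using Fin.induction with
  | zero => rfl
  | succ k ih =>
    funext b
    rw [chainLeft_succ, chainLeft_succ, h k (Fin.castSucc_lt_succ),
      ih fun j hj => h j (hj.trans Fin.castSucc_lt_succ)]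

variable {M M'} in
theorem chainRight_congr (k : Fin (d + 1)) (h : ∀ j : Fin d, k ≤ j.castSucc → M j = M' j) :
    chainRight M k = chainRight M' k := by
  induction k using Fin.reverseInduction with
  | last =>
    funext b
    rw [chainRight_last, chainRight_last]
  | cast k ih =>
    funext b
    rw [chainRight_castSucc, chainRight_castSucc, h k le_rfl,
      ih fun j hj => h j (Fin.castSucc_lt_succ.le.trans hj)]

/-- Moving the cut by one bond transfers one matrix from the right factor to the left one, so the
product does not depend on the cut. -/
theorem chainLeft_mul_chainRight (k : Fin (d + 1)) :
    ∑ a, chainLeft M k a * chainRight M k a = ∑ a, chainRight M 0 a := by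
  induction k using Fin.induction with
  | zero => simp only [chainLeft_zero, one_mul]
  | succ k ih =>
    rw [← ih]
    simp only [chainLeft_succ, chainRight_castSucc, Finset.sum_mul, Finset.mul_sum]
    rw [Finset.sum_comm]
    simp only [mul_assoc]

end Chain

theorem chainRight_tail {d : ℕ} {A : Fin (d + 2) → Type} [∀ k, Fintype (A k)]
    (M : ∀ k : Fin (d + 1), A k.castSucc → A k.succ → ℝ) (k : Fin (d + 1)) :
    chainRight (A := fun k => A k.succ) (fun k => M k.succ) k = chainRight M k.succ := by
  induction k using Fin.reverseInduction with
  | last =>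
    funext b
    rw [chainRight_last]
    exact (chainRight_last M b).symm
  | cast k ih =>
    funext b
    rw [chainRight_castSucc, ih]
    exact (chainRight_castSucc M k.succ b).symm

/-- The weight `f` on the first bond serves the induction: once the first index `a` is fixed, the
row `M 0 a` becomes the weight for the remaining chain. -/
theorem sum_prod_chain {d : ℕ} {A : Fin (d + 1) → Type} [∀ k, Fintype (A k)]
    (M : ∀ k : Fin d, A k.castSucc → A k.succ → ℝ) (f : A 0 → ℝ) :
    ∑ α : ∀ k, A k, f (α 0) * ∏ k : Fin d, M k (α k.castSucc) (α k.succ) =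
      ∑ a, f a * chainRight M 0 a := by
  induction d with
  | zero =>
    rw [← (Fin.consEquiv A).sum_comp, Fintype.sum_prod_type]
    refine Finset.sum_congr rfl fun a _ => ?_
    simp only [Finset.univ_eq_empty, Finset.prod_empty, mul_one, Fintype.sum_unique]
    rw [show chainRight M 0 a = 1 from chainRight_last M a, mul_one]
    rfl
  | succ d ih =>
    rw [← (Fin.consEquiv A).sum_comp, Fintype.sum_prod_type]
    refine Finset.sum_congr rfl fun a _ => ?_
    have h := ih (A := fun k => A k.succ) (fun k => M k.succ) (M 0 a)
    rw [chainRight_tail] at h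
    rw [show chainRight M 0 a = _ from chainRight_castSucc M 0 a]
    refine Eq.trans ?_ (congrArg (f a * ·) h)
    rw [Finset.mul_sum]
    refine Finset.sum_congr rfl fun α _ => ?_
    rw [Fin.prod_univ_succ]
    rfl

/-! ### Interfaces of a tensor train -/

section Interfaces

variable {d : ℕ} {n : Fin d → ℕ} {r : Fin (d + 1) → ℕ}

/-- The matrices `G 0 [i 0], …, G (d - 1) [i (d - 1)]`. -/
def slices (G : CoreIdx n r → ℝ) (i : ∀ k, Fin (n k)) (k : Fin d) (a : Fin (r k.castSucc))
    (b : Fin (r k.succ)) : ℝ :=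
  G ⟨k, a, i k, b⟩

/-- The row vector `G 0 [i 0] * ⋯ * G (k - 1) [i (k - 1)]` (if `r 0 = 1`). -/
def leftInterface (G : CoreIdx n r → ℝ) (k : Fin (d + 1)) (i : ∀ k, Fin (n k)) : Fin (r k) → ℝ :=
  chainLeft (A := fun k => Fin (r k)) (slices G i) k

/-- The column vector `G k [i k] * ⋯ * G (d - 1) [i (d - 1)]` (if `r d = 1`). -/
def rightInterface (G : CoreIdx n r → ℝ) (k : Fin (d + 1)) (i : ∀ k, Fin (n k)) : Fin (r k) → ℝ :=
  chainRight (A := fun k => Fin (r k)) (slices G i) k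

theorem leftInterface_zero (G : CoreIdx n r → ℝ) (i : ∀ k, Fin (n k)) (a : Fin (r 0)) :
    leftInterface G 0 i a = 1 := rfl

theorem leftInterface_succ (G : CoreIdx n r → ℝ) (i : ∀ k, Fin (n k)) (k : Fin d)
    (b : Fin (r k.succ)) :
    leftInterface G k.succ i b = ∑ a, leftInterface G k.castSucc i a * G ⟨k, a, i k, b⟩ :=
  chainLeft_succ _ _ _

theorem rightInterface_last (G : CoreIdx n r → ℝ) (i : ∀ k, Fin (n k))
    (a : Fin (r (Fin.last d))) : rightInterface G (Fin.last d) i a = 1 :=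
  chainRight_last _ _

theorem rightInterface_castSucc (G : CoreIdx n r → ℝ) (i : ∀ k, Fin (n k)) (k : Fin d)
    (a : Fin (r k.castSucc)) :
    rightInterface G k.castSucc i a = ∑ b, G ⟨k, a, i k, b⟩ * rightInterface G k.succ i b :=
  chainRight_castSucc _ _ _

theorem leftInterface_congr {G G' : CoreIdx n r → ℝ} {i i' : ∀ k, Fin (n k)} (k : Fin (d + 1))
    (h : ∀ j : Fin d, j.castSucc < k → ∀ a b, G ⟨j, a, i j, b⟩ = G' ⟨j, a, i' j, b⟩) :
    leftInterface G k i = leftInterface G' k i' :=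
  chainLeft_congr k fun j hj => funext fun a => funext fun b => h j hj a b

theorem rightInterface_congr {G G' : CoreIdx n r → ℝ} {i i' : ∀ k, Fin (n k)} (k : Fin (d + 1))
    (h : ∀ j : Fin d, k ≤ j.castSucc → ∀ a b, G ⟨j, a, i j, b⟩ = G' ⟨j, a, i' j, b⟩) :
    rightInterface G k i = rightInterface G' k i' :=
  chainRight_congr k fun j hj => funext fun a => funext fun b => h j hj a b

theorem tt_apply (G : CoreIdx n r → ℝ) (k : Fin (d + 1)) (i : ∀ k, Fin (n k)) :
    tt G i = ∑ a, leftInterface G k i a * rightInterface G k i a := by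
  have h := sum_prod_chain (A := fun k => Fin (r k)) (slices G i) fun _ => 1
  simp only [one_mul] at h
  rw [leftInterface, rightInterface, chainLeft_mul_chainRight (A := fun k => Fin (r k)), ← h]
  rfl

theorem tt_apply_core (G : CoreIdx n r → ℝ) (k : Fin d) (i : ∀ k, Fin (n k)) :
    tt G i = ∑ a, ∑ b, leftInterface G k.castSucc i a * G ⟨k, a, i k, b⟩ *
      rightInterface G k.succ i b := by
  rw [tt_apply G k.castSucc]
  simp only [rightInterface_castSucc, Finset.mul_sum, mul_assoc]

theorem leftInterface_mix (U S V : CoreIdx n r → ℝ) (μ : Fin d) (k : Fin (d + 1))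
    (h : k ≤ μ.castSucc) (i : ∀ k, Fin (n k)) :
    leftInterface (mix U S V μ) k i = leftInterface U k i :=
  leftInterface_congr k fun j hj a b => by
    have : j < μ := Fin.castSucc_lt_castSucc_iff.1 (hj.trans_le h)
    simp [mix, this]

theorem rightInterface_mix (U S V : CoreIdx n r → ℝ) (μ : Fin d) (k : Fin (d + 1))
    (h : μ.succ ≤ k) (i : ∀ k, Fin (n k)) :
    rightInterface (mix U S V μ) k i = rightInterface V k i :=
  rightInterface_congr k fun j hj a b => by
    have : μ < j := by
      have : μ.val + 1 ≤ j.val := h.trans hj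
      exact Fin.lt_def.2 this
    simp [mix, this.not_gt, this.ne']

theorem tt_mix_apply (U S V : CoreIdx n r → ℝ) (k : Fin d) (i : ∀ k, Fin (n k)) :
    tt (mix U S V k) i = ∑ a, ∑ b, leftInterface U k.castSucc i a * S ⟨k, a, i k, b⟩ *
      rightInterface V k.succ i b := by
  rw [tt_apply_core _ k, leftInterface_mix _ _ _ _ _ le_rfl, rightInterface_mix _ _ _ _ _ le_rfl]
  simp [mix]

/-! ### Scalar products -/

/-- The matrix `∑ i, G k [i] ⊗ G' k [i]`. -/
def gram (G G' : CoreIdx n r → ℝ) (k : Fin d) (p : Fin (r k.castSucc) × Fin (r k.castSucc))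
    (q : Fin (r k.succ) × Fin (r k.succ)) : ℝ :=
  ∑ i, G ⟨k, p.1, i, q.1⟩ * G' ⟨k, p.2, i, q.2⟩

/-- Summing out the modes first turns the scalar product into a chain again, now over pairs of bond
indices. It can therefore be cut at any bond `k`. -/
theorem inner_tt (G G' : CoreIdx n r → ℝ) (k : Fin (d + 1)) :
    ⟪tt G, tt G'⟫_ℝ =
      ∑ p, chainLeft (A := fun k => Fin (r k) × Fin (r k)) (gram G G') k p *
        chainRight (A := fun k => Fin (r k) × Fin (r k)) (gram G G') k p := by
  have h := sum_prod_chain (A := fun k => Fin (r k) × Fin (r k)) (gram G G') fun _ => 1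
  simp only [one_mul] at h
  rw [chainLeft_mul_chainRight (A := fun k => Fin (r k) × Fin (r k)), ← h,
    ← (Equiv.arrowProdEquivProdArrow _ _ _).symm.sum_comp,
    Fintype.sum_prod_type]
  simp only [PiLp.inner_apply, tt, RCLike.inner_apply, conj_trivial, gram,
    Equiv.arrowProdEquivProdArrow, Equiv.coe_fn_symm_mk, Finset.prod_univ_sum,
    Fintype.piFinset_univ, Finset.prod_mul_distrib]
  simp only [Finset.sum_mul_sum]
  rw [Finset.sum_comm]
  simp only [Finset.sum_comm (γ := ∀ k, Fin (n k))]
  rw [Finset.sum_comm]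
  refine Finset.sum_congr rfl fun α _ => Finset.sum_congr rfl fun α' _ => ?_
  refine Finset.sum_congr rfl fun i _ => mul_comm _ _

end Interfaces

/-! ### Gauge conditions and the isometry property of delta terms. -/

section Tangent

variable {d : ℕ} {n : Fin d → ℕ} {r : Fin (d + 1) → ℕ}

/-- Orthogonality propagates the identity matrix through the chain. It starts correctly because on a
bond of rank one the all-ones vector is the identity. -/
theorem chainLeft_gram (h0 : r 0 = 1) (G G' : CoreIdx n r → ℝ) (k : Fin (d + 1))
    (h : ∀ j : Fin d, j.castSucc < k → ∀ b b',
      ∑ i, ∑ a, G ⟨j, a, i, b⟩ * G' ⟨j, a, i, b'⟩ = if b = b' then 1 else 0)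
    (p : Fin (r k) × Fin (r k)) :
    chainLeft (A := fun k => Fin (r k) × Fin (r k)) (gram G G') k p =
      if p.1 = p.2 then 1 else 0 := by
  induction k using Fin.induction with
  | zero =>
    have : Subsingleton (Fin (r 0)) := by rw [h0]; infer_instance
    rw [chainLeft_zero, if_pos (Subsingleton.elim _ _)]
  | succ k ih =>
    rw [chainLeft_succ, ← h k Fin.castSucc_lt_succ]
    simp only [ih fun j hj => h j (hj.trans Fin.castSucc_lt_succ), gram, Fintype.sum_prod_type,
      ite_mul, one_mul, zero_mul, Finset.sum_ite_eq, Finset.mem_univ, if_true]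
    rw [Finset.sum_comm]

theorem chainRight_gram (h1 : r (Fin.last d) = 1) (G G' : CoreIdx n r → ℝ) (k : Fin (d + 1))
    (h : ∀ j : Fin d, k ≤ j.castSucc → ∀ a a',
      ∑ i, ∑ b, G ⟨j, a, i, b⟩ * G' ⟨j, a', i, b⟩ = if a = a' then 1 else 0)
    (p : Fin (r k) × Fin (r k)) :
    chainRight (A := fun k => Fin (r k) × Fin (r k)) (gram G G') k p =
      if p.1 = p.2 then 1 else 0 := by
  induction k using Fin.reverseInduction with
  | last =>
    have : Subsingleton (Fin (r (Fin.last d))) := by rw [h1]; infer_instance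
    rw [chainRight_last, if_pos (Subsingleton.elim _ _)]
  | cast k ih =>
    rw [chainRight_castSucc, ← h k le_rfl]
    simp only [ih fun j hj => h j (Fin.castSucc_lt_succ.le.trans hj), gram, Fintype.sum_prod_type,
      mul_ite, mul_one, mul_zero, Finset.sum_ite_eq, Finset.mem_univ, if_true]
    rw [Finset.sum_comm]

/-- The chain collapses to identities on both sides of position `k`, which leaves the Euclidean
product of the two delta terms. -/
theorem inner_tt_mix_self (h0 : r 0 = 1) (h1 : r (Fin.last d) = 1) {U V : CoreIdx n r → ℝ}
    (hU : ∀ k : Fin d, k.val + 1 < d → LeftOrthogonal U k)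
    (hV : ∀ k : Fin d, 0 < k.val → RightOrthogonal V k) (δ δ' : CoreIdx n r → ℝ) (k : Fin d) :
    ⟪tt (mix U δ V k), tt (mix U δ' V k)⟫_ℝ = ∑ y, δ ⟨k, y⟩ * δ' ⟨k, y⟩ := by
  have hl := chainLeft_gram h0 (mix U δ V k) (mix U δ' V k) k.castSucc fun j hj b b' => by
    have hj' : j < k := Fin.castSucc_lt_castSucc_iff.1 hj
    simp only [mix, if_pos hj']
    exact hU j (by have := Fin.lt_def.1 hj'; omega) b b'
  have hr := chainRight_gram h1 (mix U δ V k) (mix U δ' V k) k.succ fun j hj a a' => by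
    have hj' : k < j := Fin.lt_def.2 hj
    simp only [mix, if_neg hj'.not_gt, if_neg hj'.ne']
    exact hV j (by have := Fin.lt_def.1 hj'; omega) a a'
  rw [inner_tt _ _ k.castSucc]
  simp only [chainRight_castSucc, hl, hr, gram, mix, lt_irrefl, if_false, if_true,
    Fintype.sum_prod_type, ite_mul, one_mul, zero_mul, mul_ite, mul_one, mul_zero,
    Finset.sum_ite_eq, Finset.mem_univ]
  refine Finset.sum_congr rfl fun a _ => ?_
  rw [Finset.sum_comm]

/-- To the left of `k` both trains have the cores `U`, so the chain is the identity there. At `k`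
the core `U k` meets `δ k`, and the gauge condition makes the whole left factor vanish, whatever
stands to the right. -/
theorem inner_tt_mix_of_lt (h0 : r 0 = 1) {U : CoreIdx n r → ℝ}
    (hU : ∀ k : Fin d, k.val + 1 < d → LeftOrthogonal U k) (V : CoreIdx n r → ℝ)
    {δ : CoreIdx n r → ℝ} (hδ : Gauge U δ) (δ' : CoreIdx n r → ℝ) {k l : Fin d} (hkl : k < l) :
    ⟪tt (mix U δ' V l), tt (mix U δ V k)⟫_ℝ = 0 := by
  have hl := chainLeft_gram h0 (mix U δ' V l) (mix U δ V k) k.castSucc fun j hj b b' => by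
    have hj' : j < k := Fin.castSucc_lt_castSucc_iff.1 hj
    simp only [mix, if_pos hj', if_pos (hj'.trans hkl)]
    exact hU j (by have := Fin.lt_def.1 hj'; omega) b b'
  rw [inner_tt _ _ k.succ]
  refine Finset.sum_eq_zero fun q _ => ?_
  rw [chainLeft_succ]
  simp only [hl, gram, mix, lt_irrefl, if_false, if_true, if_pos hkl,
    Fintype.sum_prod_type, ite_mul, one_mul, zero_mul, Finset.sum_ite_eq, Finset.mem_univ]
  rw [Finset.sum_comm, hδ k (by have := Fin.lt_def.1 hkl; omega), zero_mul]

/-- On delta terms satisfying the gauge conditions, `tangentVector U V` is an isometry. -/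
theorem inner_tangentVector (h0 : r 0 = 1) (h1 : r (Fin.last d) = 1) {U V : CoreIdx n r → ℝ}
    (hU : ∀ k : Fin d, k.val + 1 < d → LeftOrthogonal U k)
    (hV : ∀ k : Fin d, 0 < k.val → RightOrthogonal V k) {δ δ' : CoreIdx n r → ℝ}
    (hδ : Gauge U δ) (hδ' : Gauge U δ') :
    ⟪tangentVector U V δ, tangentVector U V δ'⟫_ℝ = ∑ x, δ x * δ' x := by
  rw [tangentVector, tangentVector, sum_inner, Fintype.sum_sigma]
  refine Finset.sum_congr rfl fun k _ => ?_
  rw [inner_sum, Finset.sum_eq_single k, inner_tt_mix_self h0 h1 hU hV]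
  · intro l _ hlk
    rcases lt_or_gt_of_ne hlk with h | h
    · exact inner_tt_mix_of_lt h0 hU V hδ' δ h
    · rw [real_inner_comm]
      exact inner_tt_mix_of_lt h0 hU V hδ δ' h
  · simp

theorem tangentVector_apply (U V δ : CoreIdx n r → ℝ) (i : ∀ k, Fin (n k)) :
    tangentVector U V δ i = ∑ k, tt (mix U δ V k) i := by
  simp [tangentVector]

theorem tangentVector_add (U V δ δ' : CoreIdx n r → ℝ) :
    tangentVector U V (δ + δ') = tangentVector U V δ + tangentVector U V δ' := by
  ext i
  simp only [PiLp.add_apply, tangentVector_apply, tt_mix_apply, ← Finset.sum_add_distrib,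
    Pi.add_apply, mul_add, add_mul]

theorem tangentVector_smul (U V : CoreIdx n r → ℝ) (c : ℝ) (δ : CoreIdx n r → ℝ) :
    tangentVector U V (c • δ) = c • tangentVector U V δ := by
  ext i
  simp only [PiLp.smul_apply, tangentVector_apply, tt_mix_apply, smul_eq_mul, Finset.mul_sum,
    Pi.smul_apply]
  refine Finset.sum_congr rfl fun k _ => Finset.sum_congr rfl fun a _ =>
    Finset.sum_congr rfl fun b _ => ?_
  ring

/-- `tangentVector` as a linear map in the delta terms. -/
def tangentMap (U V : CoreIdx n r → ℝ) : (CoreIdx n r → ℝ) →ₗ[ℝ] Tensor n where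
  toFun := tangentVector U V
  map_add' := tangentVector_add U V
  map_smul' := tangentVector_smul U V

/-- Associativity for `L (P Q) R`: here `P` is absorbed into the left interface, in the primed
version `Q` into the right one. -/
theorem sum_mul_sum_mul {α β γ : Type*} [Fintype α] [Fintype β] [Fintype γ] (L : α → ℝ)
    (P : α → β → ℝ) (Q : β → γ → ℝ) (R : γ → ℝ) :
    ∑ a, ∑ c, L a * (∑ b, P a b * Q b c) * R c = ∑ b, ∑ c, (∑ a, L a * P a b) * Q b c * R c := by
  simp only [Finset.mul_sum, Finset.sum_mul]
  rw [Finset.sum_congr rfl fun a _ => Finset.sum_comm, Finset.sum_comm]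
  refine Finset.sum_congr rfl fun b _ => ?_
  rw [Finset.sum_comm]
  simp only [mul_assoc]

theorem sum_mul_sum_mul' {α β γ : Type*} [Fintype α] [Fintype β] [Fintype γ] (L : α → ℝ)
    (P : α → β → ℝ) (Q : β → γ → ℝ) (R : γ → ℝ) :
    ∑ a, ∑ c, L a * (∑ b, P a b * Q b c) * R c = ∑ a, ∑ b, L a * P a b * ∑ c, Q b c * R c := by
  simp only [Finset.mul_sum, Finset.sum_mul]
  refine Finset.sum_congr rfl fun b _ => ?_
  rw [Finset.sum_comm]
  simp only [mul_assoc]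

/-- Moving the component of the delta term `k` along `U k` into the delta term `k + 1`. -/
theorem exists_gauge_step {U : CoreIdx n r → ℝ} (V : CoreIdx n r → ℝ)
    (hU : ∀ k : Fin d, k.val + 1 < d → LeftOrthogonal U k) (k : Fin d) (hk : k.val + 1 < d)
    (δ : CoreIdx n r → ℝ) :
    ∃ δ' : CoreIdx n r → ℝ, tangentVector U V δ' = tangentVector U V δ ∧
      (∀ x : CoreIdx n r, x.1 < k → δ' x = δ x) ∧
      ∀ b b', ∑ i, ∑ a, U ⟨k, a, i, b⟩ * δ' ⟨k, a, i, b'⟩ = 0 := by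
  -- Written as `k.castSucc` and `k.succ`, the two neighbouring positions share a bond whose two
  -- descriptions agree definitionally.
  obtain ⟨d, rfl⟩ : ∃ e, d = e + 1 := ⟨d - 1, by omega⟩
  obtain ⟨k, rfl⟩ : ∃ j : Fin d, k = j.castSucc := ⟨⟨k, by omega⟩, rfl⟩
  let M (b b' : Fin (r k.succ.castSucc)) : ℝ :=
    ∑ i, ∑ a, U ⟨k.castSucc, a, i, b⟩ * δ ⟨k.castSucc, a, i, b'⟩
  -- With `M = U kᵀ δ k`, the correction is `-U k M` at position `k` and `M V (k + 1)` at the next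
  -- one. Their contributions to the tensor are `∓ U 0 ⋯ U k M V (k + 1) ⋯ V (d - 1)` and cancel.
  let E₁ : ∀ j : Fin (d + 1), Fin (r j.castSucc) × Fin (n j) × Fin (r j.succ) → ℝ :=
    Function.update 0 k.castSucc fun y => -∑ b, U ⟨k.castSucc, y.1, y.2.1, b⟩ * M b y.2.2
  let E₂ : ∀ j : Fin (d + 1), Fin (r j.castSucc) × Fin (n j) × Fin (r j.succ) → ℝ :=
    Function.update 0 k.succ fun y => ∑ b, M y.1 b * V ⟨k.succ, b, y.2.1, y.2.2⟩
  have hne : k.castSucc ≠ k.succ := Fin.castSucc_lt_succ.ne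
  have hE₁ : E₁ k.castSucc = _ := Function.update_self _ _ _
  have hE₂ : E₂ k.succ = _ := Function.update_self _ _ _
  have hE₁' : ∀ j, j ≠ k.castSucc → E₁ j = 0 := fun j hj => Function.update_of_ne hj _ _
  have hE₂' : ∀ j, j ≠ k.succ → E₂ j = 0 := fun j hj => Function.update_of_ne hj _ _
  refine ⟨δ + ((fun x => E₁ x.1 x.2) + fun x => E₂ x.1 x.2), ?_, ?_, ?_⟩
  · rw [tangentVector_add, tangentVector_add, add_eq_left]
    ext i
    simp only [PiLp.add_apply, tangentVector_apply, tt_mix_apply, PiLp.zero_apply]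
    rw [Finset.sum_eq_single k.castSucc, Finset.sum_eq_single k.succ]
    · simp only [hE₁, hE₂, mul_neg, neg_mul, Finset.sum_neg_distrib]
      rw [neg_add_eq_zero]
      refine (sum_mul_sum_mul _ _ _ _).trans (Eq.trans ?_ (sum_mul_sum_mul' _ _ _ _).symm)
      refine Finset.sum_congr rfl fun b _ => Finset.sum_congr rfl fun c _ => ?_
      rw [← leftInterface_succ, ← rightInterface_castSucc]
      rfl
    · intro j _ hj
      simp [hE₂' j hj]
    · simp
    · intro j _ hj
      simp [hE₁' j hj]
    · simp
  · intro x hx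
    have h1 : x.1 ≠ k.castSucc := hx.ne
    have h2 : x.1 ≠ k.succ := (hx.trans Fin.castSucc_lt_succ).ne
    simp [hE₁' _ h1, hE₂' _ h2]
  · intro b b'
    change ∑ i, ∑ a, U ⟨k.castSucc, a, i, b⟩ * (δ ⟨k.castSucc, a, i, b'⟩ +
      (E₁ k.castSucc (a, i, b') + E₂ k.castSucc (a, i, b'))) = 0
    simp only [hE₁, hE₂' _ hne, Pi.zero_apply, add_zero, mul_add, Finset.sum_add_distrib, mul_neg,
      Finset.sum_neg_distrib, Finset.mul_sum]
    rw [add_neg_eq_zero]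
    have e : ∑ c, (∑ i, ∑ a, U ⟨k.castSucc, a, i, b⟩ * U ⟨k.castSucc, a, i, c⟩) * M c b' =
        M b b' := by
      simp only [hU k.castSucc hk b, ite_mul, one_mul, zero_mul]
      exact (Finset.sum_ite_eq _ _ _).trans (if_pos (Finset.mem_univ _))
    refine e.symm.trans ?_
    simp only [Finset.sum_mul]
    rw [Finset.sum_comm]
    refine Finset.sum_congr rfl fun i _ => ?_
    rw [Finset.sum_comm]
    simp only [mul_assoc]

/-- Apply the step at `k = 0, …, d - 2` in this order. Each step leaves the earlier delta terms
alone, so gauge conditions already achieved persist, and the last delta term, which has no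
condition, takes the remainder. -/
theorem exists_gauge {U : CoreIdx n r → ℝ} (V : CoreIdx n r → ℝ)
    (hU : ∀ k : Fin d, k.val + 1 < d → LeftOrthogonal U k) (δ : CoreIdx n r → ℝ) :
    ∃ δ' : CoreIdx n r → ℝ, Gauge U δ' ∧ tangentVector U V δ' = tangentVector U V δ := by
  have key : ∀ m : ℕ, ∃ δ' : CoreIdx n r → ℝ, tangentVector U V δ' = tangentVector U V δ ∧
      ∀ k : Fin d, k.val < m → k.val + 1 < d → ∀ b b' : Fin (r k.succ),
        ∑ i, ∑ a, U ⟨k, a, i, b⟩ * δ' ⟨k, a, i, b'⟩ = 0 := by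
    intro m
    induction m with
    | zero => exact ⟨δ, rfl, fun k hk => absurd hk (by omega)⟩
    | succ m ih =>
      obtain ⟨δ₁, h₁, g₁⟩ := ih
      by_cases hm : m + 1 < d
      · obtain ⟨δ₂, h₂, e₂, g₂⟩ := exists_gauge_step V hU ⟨m, by omega⟩ hm δ₁
        refine ⟨δ₂, h₂.trans h₁, fun k hk hkd b b' => ?_⟩
        rcases Nat.lt_succ_iff_lt_or_eq.1 hk with h | h
        · rw [← g₁ k h hkd b b']
          refine Finset.sum_congr rfl fun i _ => Finset.sum_congr rfl fun a _ => ?_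
          rw [e₂ _ (Fin.lt_def.2 h)]
        · subst h
          exact g₂ b b'
      · exact ⟨δ₁, h₁, fun k hk hkd => g₁ k (by omega) hkd⟩
  obtain ⟨δ', h, g⟩ := key d
  exact ⟨δ', fun k hk => g k k.isLt hk, h⟩

end Tangent

/-! ### Full-rank unfoldings and independence of the tangent space from the orthogonalization. -/

theorem exists_mul_eq_one_of_card_le_rank {l o : Type*} [Fintype l] [Fintype o] [DecidableEq l]
    (B : Matrix l o ℝ) (h : Fintype.card l ≤ B.rank) : ∃ P : Matrix o l ℝ, B * P = 1 := by
  rw [← Matrix.mulVec_surjective_iff_exists_right_inverse]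
  have : LinearMap.range B.mulVecLin = ⊤ := by
    apply Submodule.eq_top_of_finrank_eq
    rw [Module.finrank_fintype_fun_eq_card]
    exact le_antisymm B.rank_le_card_height h
  exact LinearMap.range_eq_top.1 this

/-- The rank of a product is at most that of each factor, so if it equals the inner dimension then
`A` has full column rank and `B` full row rank. -/
theorem exists_inverses_of_rank_mul {m l o : Type*} [Fintype m] [Fintype l] [Fintype o]
    [DecidableEq l] (A : Matrix m l ℝ) (B : Matrix l o ℝ)
    (h : (A * B).rank = Fintype.card l) :
    (∃ P : Matrix l m ℝ, P * A = 1) ∧ ∃ P : Matrix o l ℝ, B * P = 1 := by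
  constructor
  · obtain ⟨P, hP⟩ := exists_mul_eq_one_of_card_le_rank A.transpose (by
      rw [Matrix.rank_transpose, ← h]
      exact Matrix.rank_mul_le_left A B)
    exact ⟨P.transpose, by
      rw [← Matrix.transpose_one, ← hP, Matrix.transpose_mul, Matrix.transpose_transpose]⟩
  · exact exists_mul_eq_one_of_card_le_rank B (by
      rw [← h]
      exact Matrix.rank_mul_le_right A B)

section Unfolding

variable {d : ℕ} {n : Fin d → ℕ} {r : Fin (d + 1) → ℕ}

/-- A multi-index composed of its first `k` entries and the other ones. -/
def glue {n : Fin d → ℕ} (k : ℕ) (a : ∀ j : {j : Fin d // j.val < k}, Fin (n j))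
    (b : ∀ j : {j : Fin d // ¬ j.val < k}, Fin (n j)) (j : Fin d) : Fin (n j) :=
  if h : j.val < k then a ⟨j, h⟩ else b ⟨j, h⟩

/-- The left interface as a matrix whose columns are indexed by the bond `k`. -/
def leftMatrix (G : CoreIdx n r → ℝ) (k : Fin (d + 1)) (i : ∀ k, Fin (n k)) :
    Matrix (∀ j : {j : Fin d // j.val < k.val}, Fin (n j)) (Fin (r k)) ℝ :=
  Matrix.of fun a => leftInterface G k (glue k a fun j => i j)

/-- The right interface as a matrix whose rows are indexed by the bond `k`. -/
def rightMatrix (G : CoreIdx n r → ℝ) (k : Fin (d + 1)) (i : ∀ k, Fin (n k)) :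
    Matrix (Fin (r k)) (∀ j : {j : Fin d // ¬ j.val < k.val}, Fin (n j)) ℝ :=
  Matrix.of fun c b => rightInterface G k (glue k (fun j => i j) b) c

/-- The left interface at bond `k` reads only the first `k` entries of the multi-index, so the
filler `i` is irrelevant. -/
theorem leftInterface_eq_leftMatrix (G : CoreIdx n r → ℝ) (k : Fin (d + 1))
    (i i' : ∀ k, Fin (n k)) (c : Fin (r k)) :
    leftInterface G k i' c = leftMatrix G k i (fun j => i' j) c := by
  refine congrFun (leftInterface_congr k fun j hj a b => ?_) c
  have : j.val < k.val := hj
  simp [glue, this]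

theorem rightInterface_eq_rightMatrix (G : CoreIdx n r → ℝ) (k : Fin (d + 1))
    (i i' : ∀ k, Fin (n k)) (c : Fin (r k)) :
    rightInterface G k i' c = rightMatrix G k i c (fun j => i' j) := by
  refine congrFun (rightInterface_congr k fun j hj a b => ?_) c
  have : ¬ j.val < k.val := not_lt.2 hj
  simp [glue, this]

theorem unfolding_tt (G : CoreIdx n r → ℝ) (k : Fin (d + 1)) (i : ∀ k, Fin (n k)) :
    unfolding (tt G) k.val = leftMatrix G k i * rightMatrix G k i := by
  ext a b
  rw [Matrix.mul_apply]
  change tt G (glue k a b) = _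
  rw [tt_apply G k]
  refine Finset.sum_congr rfl fun c _ => ?_
  rw [leftInterface_eq_leftMatrix G k i, rightInterface_eq_rightMatrix G k i]
  congr 2
  · funext j
    simp [glue, j.2]
  · funext j
    simp [glue, j.2]

theorem leftInterface_injective (hn : ∀ k, 1 ≤ n k) (G : CoreIdx n r → ℝ) (k : Fin (d + 1))
    (hk : (unfolding (tt G) k.val).rank = r k) (v : Fin (r k) → ℝ)
    (hv : ∀ i, ∑ a, leftInterface G k i a * v a = 0) : v = 0 := by
  let i : ∀ k, Fin (n k) := fun k => ⟨0, hn k⟩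
  rw [unfolding_tt G k i] at hk
  obtain ⟨P, hP⟩ := (exists_inverses_of_rank_mul _ _ (hk.trans (Fintype.card_fin _).symm)).1
  rw [← Matrix.one_mulVec v, ← hP, ← Matrix.mulVec_mulVec,
    show (leftMatrix G k i).mulVec v = 0 from funext fun a => hv _, Matrix.mulVec_zero]

theorem rightInterface_injective (hn : ∀ k, 1 ≤ n k) (G : CoreIdx n r → ℝ) (k : Fin (d + 1))
    (hk : (unfolding (tt G) k.val).rank = r k) (v : Fin (r k) → ℝ)
    (hv : ∀ i, ∑ a, v a * rightInterface G k i a = 0) : v = 0 := by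
  let i : ∀ k, Fin (n k) := fun k => ⟨0, hn k⟩
  rw [unfolding_tt G k i] at hk
  obtain ⟨P, hP⟩ := (exists_inverses_of_rank_mul _ _ (hk.trans (Fintype.card_fin _).symm)).2
  rw [← Matrix.vecMul_one v, ← hP, ← Matrix.vecMul_vecMul,
    show Matrix.vecMul v (rightMatrix G k i) = 0 from funext fun a => hv _, Matrix.zero_vecMul]

/-- The left interfaces of two decompositions of the same tensor have the same range. -/
theorem exists_leftInterface_eq (hn : ∀ k, 1 ≤ n k) {G G' : CoreIdx n r → ℝ}
    (h : tt G' = tt G) (k : Fin (d + 1)) (hk : (unfolding (tt G) k.val).rank = r k) :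
    ∃ Q : Matrix (Fin (r k)) (Fin (r k)) ℝ, ∀ i b,
      leftInterface G' k i b = ∑ a, leftInterface G k i a * Q a b := by
  let i : ∀ k, Fin (n k) := fun k => ⟨0, hn k⟩
  have hk' := hk
  rw [← h, unfolding_tt G' k i] at hk'
  obtain ⟨P, hP⟩ := (exists_inverses_of_rank_mul _ _ (hk'.trans (Fintype.card_fin _).symm)).2
  refine ⟨rightMatrix G k i * P, fun i' b => ?_⟩
  -- From `A' B' = A B` and `B' P = 1` follows `A' = A (B P)`.
  have e : leftMatrix G' k i = leftMatrix G k i * (rightMatrix G k i * P) := by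
    rw [← Matrix.mul_assoc, ← unfolding_tt, ← h, unfolding_tt G' k i, Matrix.mul_assoc, hP,
      Matrix.mul_one]
  rw [leftInterface_eq_leftMatrix G' k i, e, Matrix.mul_apply]
  simp only [leftInterface_eq_leftMatrix G k i]

/-- The right interfaces of two decompositions of the same tensor have the same range. -/
theorem exists_rightInterface_eq (hn : ∀ k, 1 ≤ n k) {G G' : CoreIdx n r → ℝ}
    (h : tt G' = tt G) (k : Fin (d + 1)) (hk : (unfolding (tt G) k.val).rank = r k) :
    ∃ Q : Matrix (Fin (r k)) (Fin (r k)) ℝ, ∀ i a,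
      rightInterface G' k i a = ∑ b, Q a b * rightInterface G k i b := by
  let i : ∀ k, Fin (n k) := fun k => ⟨0, hn k⟩
  have hk' := hk
  rw [← h, unfolding_tt G' k i] at hk'
  obtain ⟨P, hP⟩ := (exists_inverses_of_rank_mul _ _ (hk'.trans (Fintype.card_fin _).symm)).1
  refine ⟨P * leftMatrix G k i, fun i' b => ?_⟩
  have e : rightMatrix G' k i = P * leftMatrix G k i * rightMatrix G k i := by
    rw [Matrix.mul_assoc, ← unfolding_tt, ← h, unfolding_tt G' k i, ← Matrix.mul_assoc, hP,
      Matrix.one_mul]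
  rw [rightInterface_eq_rightMatrix G' k i, e, Matrix.mul_apply]
  simp only [rightInterface_eq_rightMatrix G k i]

/-- Every orthogonalization of `X` gives the same tangent vectors. -/
theorem exists_tangentVector_eq (hn : ∀ k, 1 ≤ n k) {X : Tensor n}
    (hX : X ∈ ttManifold n r) {U S V U' S' V' : CoreIdx n r → ℝ}
    (h : IsOrthogonalization X U S V) (h' : IsOrthogonalization X U' S' V')
    (δ' : CoreIdx n r → ℝ) :
    ∃ δ, tangentVector U V δ = tangentVector U' V' δ' := by
  have left : ∀ k : Fin d, ∃ Q : Matrix (Fin (r k.castSucc)) (Fin (r k.castSucc)) ℝ, ∀ i b,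
      leftInterface U' k.castSucc i b = ∑ a, leftInterface U k.castSucc i a * Q a b := by
    intro k
    by_cases hk : k.castSucc = 0
    -- At the outer bond there is no rank condition to use, but the interface there is an empty
    -- product and the same for all cores.
    · refine ⟨1, fun i b => ?_⟩
      simp only [Matrix.one_apply, mul_ite, mul_one, mul_zero, Finset.sum_ite_eq', Finset.mem_univ,
        if_true]
      exact congrFun (leftInterface_congr _ fun j hj => absurd hj (by rw [hk]; exact not_lt_zero)) b
    · have := exists_leftInterface_eq hn ((h'.eq k).trans (h.eq k).symm) k.castSucc
        (by rw [h.eq k]; exact hX _ hk (Fin.castSucc_lt_last k).ne)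
      simpa only [leftInterface_mix _ _ _ _ _ le_rfl] using this
  have right : ∀ k : Fin d, ∃ Q : Matrix (Fin (r k.succ)) (Fin (r k.succ)) ℝ, ∀ i a,
      rightInterface V' k.succ i a = ∑ b, Q a b * rightInterface V k.succ i b := by
    intro k
    by_cases hk : k.succ = Fin.last d
    · refine ⟨1, fun i a => ?_⟩
      simp only [Matrix.one_apply, ite_mul, one_mul, zero_mul, Finset.sum_ite_eq, Finset.mem_univ,
        if_true]
      exact congrFun (rightInterface_congr _ fun j hj => absurd hj
        (by rw [hk]; exact (Fin.castSucc_lt_last j).not_ge)) a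
    · have := exists_rightInterface_eq hn ((h'.eq k).trans (h.eq k).symm) k.succ
        (by rw [h.eq k]; exact hX _ (Fin.succ_ne_zero k) hk)
      simpa only [rightInterface_mix _ _ _ _ _ le_rfl] using this
  choose P hP using left
  choose Q hQ using right
  -- The base changes of the interfaces are absorbed into the delta terms: `δ k = P k δ' k Q k`.
  refine ⟨fun x => ∑ a, ∑ b, P x.1 x.2.1 a * δ' ⟨x.1, a, x.2.2.1, b⟩ * Q x.1 b x.2.2.2, ?_⟩
  ext i
  simp only [tangentVector_apply, tt_mix_apply]
  refine Finset.sum_congr rfl fun k _ => ?_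
  let L : Matrix Unit _ ℝ := Matrix.of fun _ => leftInterface U k.castSucc i
  let L' : Matrix Unit _ ℝ := Matrix.of fun _ => leftInterface U' k.castSucc i
  let R : Matrix _ Unit ℝ := Matrix.of fun b _ => rightInterface V k.succ i b
  let R' : Matrix _ Unit ℝ := Matrix.of fun b _ => rightInterface V' k.succ i b
  let Δ : Matrix (Fin (r k.castSucc)) (Fin (r k.succ)) ℝ :=
    Matrix.of fun a b => δ' ⟨k, a, i k, b⟩
  have hL : L' = L * P k := by
    ext u b
    exact hP k i b
  have hR : R' = Q k * R := by
    ext b u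
    exact hQ k i b
  have e₁ : L * (P k * Δ * Q k) * R = L' * Δ * R' := by
    rw [hL, hR]
    simp only [Matrix.mul_assoc]
  have e₂ : ∀ (L : Matrix Unit (Fin (r k.castSucc)) ℝ) (Δ : Matrix _ _ ℝ)
      (R : Matrix (Fin (r k.succ)) Unit ℝ),
      (L * Δ * R) () () = ∑ a, ∑ b, L () a * Δ a b * R b () := by
    intro L Δ R
    simp only [Matrix.mul_apply, Finset.sum_mul]
    exact Finset.sum_comm
  have e₃ := congrFun (congrFun e₁ ()) ()
  rw [e₂, e₂] at e₃
  refine Eq.trans ?_ e₃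
  refine Finset.sum_congr rfl fun a _ => Finset.sum_congr rfl fun b _ => ?_
  simp only [Matrix.mul_apply, Finset.sum_mul]
  rw [Finset.sum_comm]
  rfl

theorem tangentSpace_eq_range (hn : ∀ k, 1 ≤ n k) {X : Tensor n} (hX : X ∈ ttManifold n r)
    {U S V : CoreIdx n r → ℝ} (h : IsOrthogonalization X U S V) :
    tangentSpace r X = LinearMap.range (tangentMap U V) := by
  apply le_antisymm
  · rw [tangentSpace, Submodule.span_le]
    rintro T ⟨U', S', V', h', δ', rfl⟩
    obtain ⟨δ, hδ⟩ := exists_tangentVector_eq hn hX h h' δ'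
    exact ⟨δ, hδ⟩
  · rintro _ ⟨δ, rfl⟩
    exact Submodule.subset_span ⟨U, S, V, h, δ, rfl⟩

end Unfolding

/-! ### The block cores of a tangent vector -/

section Block

variable {d : ℕ} {n : Fin d → ℕ} {r : Fin (d + 1) → ℕ}

/-- `hF` compensates for the first bond, where `block` takes values only in the second block. -/
theorem sum_block (k : Fin (d + 1)) (hk : k ≠ Fin.last d) (F : Fin (r k) ⊕ Fin (r k) → ℝ)
    (hF : k = 0 → ∀ a, F (.inl a) = 0) :
    ∑ a, F (block r k a) = ∑ a, F (.inl a) + ∑ a, F (.inr a) := by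
  by_cases h0 : k = 0
  · have e : r k = doubleRank r k := by simp [doubleRank, h0]
    rw [Finset.sum_eq_zero fun a _ => hF h0 a, zero_add, ← (finCongr e).sum_comp]
    refine Finset.sum_congr rfl fun a _ => ?_
    congr 1
    simp [block, h0]
  · have e : r k + r k = doubleRank r k := by simp [doubleRank, h0, hk, two_mul]
    rw [← (finSumFinEquiv.trans (finCongr e)).sum_comp, Fintype.sum_sum_type]
    congr 1 <;> refine Finset.sum_congr rfl fun a _ => ?_ <;> congr 1 <;> simp [block, h0, hk]

theorem sum_block_last (hd : d ≠ 0) (F : Fin (r (Fin.last d)) ⊕ Fin (r (Fin.last d)) → ℝ) :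
    ∑ a, F (block r (Fin.last d) a) = ∑ a, F (.inl a) := by
  have h0 : Fin.last d ≠ 0 := fun h => hd (by simpa using congrArg Fin.val h)
  have e : r (Fin.last d) = doubleRank r (Fin.last d) := by simp [doubleRank]
  rw [← (finCongr e).sum_comp]
  refine Finset.sum_congr rfl fun a _ => ?_
  congr 1
  simp [block, h0]

/-- The product of the first `k` block cores is a row of two blocks. The second is the product of
the `U`; the first collects all terms whose delta core has already occurred. Multiplying by the next
block core continues the old terms with `V` and opens a new one with `R`. -/
theorem leftInterface_deltasToCores (x : GVar (CoreIdx n r) → ℝ) (i : ∀ k, Fin (n k))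
    (k : Fin (d + 1)) (a : Fin (doubleRank r k)) :
    leftInterface ((deltasToCores n r).eval x) k i a =
      Sum.elim (fun a => ∑ j : Fin d with j.castSucc < k,
          leftInterface (mix (fun y => x (.U y)) (fun y => x (.R y)) (fun y => x (.V y)) j) k i a)
        (leftInterface (fun y => x (.U y)) k i) (block r k a) := by
  induction k using Fin.induction with
  | zero => simp [block, leftInterface_zero]
  | succ k ih =>
    rw [leftInterface_succ]
    have e : ∀ a b, (deltasToCores n r).eval x ⟨k, a, i k, b⟩ =
        match block r k.castSucc a, block r k.succ b with
        | .inl a, .inl b => x (.V ⟨k, a, i k, b⟩)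
        | .inl _, .inr _ => 0
        | .inr a, .inl b => x (.R ⟨k, a, i k, b⟩)
        | .inr a, .inr b => x (.U ⟨k, a, i k, b⟩) := by
      intro a b
      simp only [deltasToCores, Prog.eval]
      cases block r k.castSucc a <;> cases block r k.succ b <;> rfl
    have hs : (Finset.univ.filter fun j : Fin d => j.castSucc < k.succ) =
        insert k (Finset.univ.filter fun j : Fin d => j.castSucc < k.castSucc) := by
      ext j
      simp only [Finset.mem_filter, Finset.mem_univ, true_and, Finset.mem_insert, Fin.lt_def,
        Fin.ext_iff, Fin.val_castSucc, Fin.val_succ]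
      omega
    simp only [ih, e]
    rw [sum_block k.castSucc (Fin.castSucc_lt_last k).ne (fun s => Sum.elim _ _ s *
      match s, block r k.succ a with
        | .inl a, .inl b => x (.V ⟨k, a, i k, b⟩)
        | .inl _, .inr _ => 0
        | .inr a, .inl b => x (.R ⟨k, a, i k, b⟩)
        | .inr a, .inr b => x (.U ⟨k, a, i k, b⟩)) (by
        intro h a
        simp [h])]
    cases block r k.succ a with
    | inl b =>
      simp only [Sum.elim_inl, Sum.elim_inr]
      rw [hs, Finset.sum_insert (by simp), add_comm]
      congr 1
      · rw [leftInterface_succ, leftInterface_mix _ _ _ _ _ le_rfl]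
        simp [mix]
      · simp only [Finset.sum_mul]
        rw [Finset.sum_comm]
        refine Finset.sum_congr rfl fun j hj => ?_
        have hj' : j < k := Fin.castSucc_lt_castSucc_iff.1 (Finset.mem_filter.1 hj).2
        rw [leftInterface_succ]
        simp [mix, hj'.not_gt, hj'.ne']
    | inr b =>
      simp only [Sum.elim_inl, Sum.elim_inr, mul_zero, Finset.sum_const_zero, zero_add]
      rw [leftInterface_succ]

theorem tt_deltasToCores (hd : d ≠ 0) (x : GVar (CoreIdx n r) → ℝ) :
    tt ((deltasToCores n r).eval x) =
      tangentVector (fun y => x (.U y)) (fun y => x (.V y)) (fun y => x (.R y)) := by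
  ext i
  rw [tt_apply _ (Fin.last d), tangentVector_apply]
  simp only [rightInterface_last, mul_one, leftInterface_deltasToCores]
  rw [sum_block_last hd]
  simp only [Sum.elim_inl, Fin.castSucc_lt_last, Finset.filter_true]
  rw [Finset.sum_comm]
  refine Finset.sum_congr rfl fun j _ => ?_
  rw [tt_apply _ (Fin.last d)]
  simp only [rightInterface_last, mul_one]

theorem regular_deltasToCores (x : GVar (CoreIdx n r) → ℝ) : (deltasToCores n r).Regular x :=
  ⟨trivial, trivial⟩

end Block

/-! ### Gram–Schmidt -/

section GramSchmidt

variable {ι : Type} [Fintype ι] {c : ℕ}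

/-- State `q` of the Gram–Schmidt process for `a` after `k` steps. -/
structure IsGramSchmidtState (a : Fin c → ι → ℝ) (k : ℕ) (q : Fin c → ι → ℝ) : Prop where
  zero : ∀ l : Fin c, k ≤ l.val → q l = 0
  orthonormal : ∀ l l' : Fin c, l.val < k → l'.val < k → q l ⬝ᵥ q l' = if l = l' then 1 else 0
  mem_span : ∀ l, q l ∈ Submodule.span ℝ (a '' {i | i.val < k})
  eq_sum : ∀ i : Fin c, i.val < k → a i = ∑ l, (q l ⬝ᵥ a i) • q l

/-- Columns not yet processed are zero, so the projection may be summed over all columns, as the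
program does. -/
theorem IsGramSchmidtState.step {a : Fin c → ι → ℝ} (ha : LinearIndependent ℝ a) (j : Fin c)
    {q : Fin c → ι → ℝ} (h : IsGramSchmidtState a j q) {v : ι → ℝ}
    (hv : v = a j - ∑ l, (q l ⬝ᵥ a j) • q l) :
    0 < v ⬝ᵥ v ∧ IsGramSchmidtState a (j + 1)
      (Function.update q j ((Real.sqrt (v ⬝ᵥ v))⁻¹ • v)) := by
  have hsum : ∑ l, (q l ⬝ᵥ a j) • q l ∈ Submodule.span ℝ (a '' {i | i.val < j.val}) :=
    Submodule.sum_mem _ fun l _ => Submodule.smul_mem _ _ (h.mem_span l)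
  -- If `v = 0`, then `a j` lies in the span of the earlier columns, against linear independence. So
  -- the norm is positive and division by it is legitimate.
  have hv0 : v ≠ 0 := by
    intro h0
    rw [h0, eq_comm, sub_eq_zero] at hv
    rw [← hv] at hsum
    exact ha.notMem_span_image (s := {i | i.val < j.val}) (x := j) (by simp) hsum
  have hpos : 0 < v ⬝ᵥ v :=
    lt_of_le_of_ne (Finset.sum_nonneg fun _ _ => mul_self_nonneg _)
      (Ne.symm (by simpa [dotProduct_self_eq_zero] using hv0))
  have hvq : ∀ l, q l ⬝ᵥ v = 0 := by
    intro l
    by_cases hl : l.val < j.val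
    · rw [hv, dotProduct_sub, dotProduct_sum, Finset.sum_eq_single l]
      · rw [dotProduct_smul, h.orthonormal l l hl hl]
        simp
      · intro l' _ hne
        rw [dotProduct_smul]
        by_cases hl' : l'.val < j.val
        · rw [h.orthonormal l l' hl hl', if_neg hne.symm, smul_zero]
        · rw [h.zero l' (not_lt.1 hl')]
          simp
      · simp
    · rw [h.zero l (not_lt.1 hl), zero_dotProduct]
  have hvq' : ∀ l, v ⬝ᵥ q l = 0 := fun l => (dotProduct_comm _ _).trans (hvq l)
  have hva : ∀ i : Fin c, i.val < j.val → v ⬝ᵥ a i = 0 := by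
    intro i hi
    rw [h.eq_sum i hi, dotProduct_sum]
    refine Finset.sum_eq_zero fun l _ => ?_
    rw [dotProduct_smul, hvq', smul_zero]
  have hvaj : v ⬝ᵥ a j = v ⬝ᵥ v := by
    have : a j = v + ∑ l, (q l ⬝ᵥ a j) • q l := by rw [hv]; abel
    conv_lhs => rw [this]
    rw [dotProduct_add, dotProduct_sum, Finset.sum_eq_zero, add_zero]
    intro l _
    rw [dotProduct_smul, hvq', smul_zero]
  have hss : Real.sqrt (v ⬝ᵥ v) * Real.sqrt (v ⬝ᵥ v) = v ⬝ᵥ v := Real.mul_self_sqrt hpos.le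
  have hone : (Real.sqrt (v ⬝ᵥ v))⁻¹ * (v ⬝ᵥ v) * (Real.sqrt (v ⬝ᵥ v))⁻¹ = 1 := by
    rw [mul_right_comm, ← mul_inv, hss, inv_mul_cancel₀ hpos.ne']
  have hmono : Submodule.span ℝ (a '' {i | i.val < j.val}) ≤
      Submodule.span ℝ (a '' {i | i.val < j.val + 1}) :=
    Submodule.span_mono (Set.image_mono fun i (hi : i.val < j.val) => Nat.lt_succ_of_lt hi)
  set e := (Real.sqrt (v ⬝ᵥ v))⁻¹ • v with he
  have hnew : ∀ i, ∑ l, (Function.update q j e l ⬝ᵥ a i) • Function.update q j e l =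
      (e ⬝ᵥ a i) • e + ∑ l, (q l ⬝ᵥ a i) • q l := by
    intro i
    rw [← Finset.add_sum_erase _ _ (Finset.mem_univ j),
      ← Finset.add_sum_erase _ (fun l => (q l ⬝ᵥ a i) • q l) (Finset.mem_univ j),
      h.zero j le_rfl, smul_zero, zero_add, Function.update_self]
    congr 1
    refine Finset.sum_congr rfl fun l hl => ?_
    rw [Function.update_of_ne (Finset.ne_of_mem_erase hl)]
  refine ⟨hpos, ?_, ?_, ?_, ?_⟩
  · intro l hl
    rw [Function.update_of_ne (by rintro rfl; omega), h.zero l (by omega)]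
  · intro l l' hl hl'
    by_cases h1 : l = j <;> by_cases h2 : l' = j
    · subst h1 h2
      rw [Function.update_self, if_pos rfl, he, smul_dotProduct, dotProduct_smul,
        smul_eq_mul, smul_eq_mul, mul_comm, mul_comm _ (v ⬝ᵥ v), mul_comm (v ⬝ᵥ v), hone]
    · subst h1
      rw [Function.update_self, Function.update_of_ne h2, if_neg (Ne.symm h2), he,
        smul_dotProduct, hvq', smul_zero]
    · subst h2
      rw [Function.update_self, Function.update_of_ne h1, if_neg h1, he, dotProduct_smul, hvq,
        smul_zero]
    · rw [Function.update_of_ne h1, Function.update_of_ne h2]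
      exact h.orthonormal l l' (by omega) (by omega)
  · intro l
    by_cases h1 : l = j
    · subst h1
      rw [Function.update_self]
      refine Submodule.smul_mem _ _ ?_
      rw [hv]
      exact Submodule.sub_mem _ (Submodule.subset_span ⟨l, Nat.lt_succ_self _, rfl⟩) (hmono hsum)
    · rw [Function.update_of_ne h1]
      exact hmono (h.mem_span l)
  · intro i hi
    rw [hnew i]
    by_cases h1 : i = j
    · subst h1
      rw [he, smul_dotProduct, hvaj, smul_smul, smul_eq_mul]
      rw [hone, one_smul, hv]
      abel
    · have hij : i.val < j.val := by omega
      rw [he, smul_dotProduct, hva i hij, smul_zero, zero_smul, zero_add]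
      exact h.eq_sum i hij

theorem Prog.eval_gramSchmidtStep (j : Fin c) (A s : ι × Fin c → ℝ) {v : ι → ℝ}
    (hv : v = (fun x => A (x, j)) -
      ∑ l, ((fun x => s (x, l)) ⬝ᵥ fun x => A (x, j)) • fun x => s (x, l)) (x : ι) (l : Fin c) :
    (gramSchmidtStep j).eval (Sum.elim A s) (x, l) =
      Function.update (fun l x => s (x, l)) j ((Real.sqrt (v ⬝ᵥ v))⁻¹ • v) l x := by
  have hv' : ∀ x, A (x, j) - ∑ l, s (x, l) * ∑ y, s (y, l) * A (y, j) = v x := by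
    intro x
    simp [hv, dotProduct, mul_comm]
  simp only [gramSchmidtStep, eval_bind, eval_ret]
  by_cases h : l = j
  · subst h
    simp [eval_bind, eval_vec, eval_dot, eval_op, Op.eval, hv', dotProduct]
    rw [div_eq_inv_mul]
  · simp [h]

theorem Prog.regular_gramSchmidtStep (j : Fin c) (A s : ι × Fin c → ℝ) {v : ι → ℝ}
    (hv : v = (fun x => A (x, j)) -
      ∑ l, ((fun x => s (x, l)) ⬝ᵥ fun x => A (x, j)) • fun x => s (x, l)) (hpos : 0 < v ⬝ᵥ v) :
    (gramSchmidtStep j).Regular (Sum.elim A s) := by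
  have hv' : ∀ x, A (x, j) - ∑ l, s (x, l) * ∑ y, s (y, l) * A (y, j) = v x := by
    intro x
    simp [hv, dotProduct, mul_comm]
  have h2 := (Real.sqrt_pos.2 hpos).ne'
  simp only [dotProduct] at hpos h2
  simp [gramSchmidtStep, regular_bind, regular_vec, regular_dot, regular_op, regular_ret, eval_bind,
    eval_vec, eval_dot, eval_op, Op.eval, Op.Regular, hv', hpos, h2]

/-- The sweeps need only `Qᵀ Q = 1` and `Q R = A`, not that `R` is triangular. -/
theorem Prog.qr_spec (A : ι × Fin c → ℝ) (hA : LinearIndependent ℝ fun j x => A (x, j)) :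
    (qr ι c).Regular A ∧
    (∀ i i', ∑ x, (qr ι c).eval A (.inr (x, i)) * (qr ι c).eval A (.inr (x, i')) =
      if i = i' then 1 else 0) ∧
    ∀ x j, ∑ l, (qr ι c).eval A (.inr (x, l)) * (qr ι c).eval A (.inl (l, j)) = A (x, j) := by
  have key := loop_invariant A c gramSchmidtStep
    (fun k s => IsGramSchmidtState (fun j x => A (x, j)) k (fun l x => s (x, l)))
    (by
      intro k s hs
      obtain ⟨h1, h2⟩ := hs.step hA k rfl
      refine ⟨regular_gramSchmidtStep k A s rfl h1, ?_⟩
      convert h2 using 1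
      funext l x
      exact eval_gramSchmidtStep k A s rfl x l)
    (fun _ => 0) ⟨fun _ _ => rfl, fun _ _ h => absurd h (Nat.not_lt_zero _),
      fun _ => Submodule.zero_mem _, fun _ h => absurd h (Nat.not_lt_zero _)⟩
  obtain ⟨hreg, hI⟩ := key
  have hinit : Sum.elim A ((step (.const 0) (ret fun _ => none) :
      Prog (ι × Fin c) (ι × Fin c)).eval A) = Sum.elim A fun _ => 0 := rfl
  have hQ : ∀ x, (qr ι c).eval A (.inr x) =
      (loop c gramSchmidtStep).eval (Sum.elim A fun _ => 0) x := by
    intro x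
    simp [qr, eval_bind, eval_ret, hinit]
  have hR : ∀ i j, (qr ι c).eval A (.inl (i, j)) =
      ∑ x, (loop c gramSchmidtStep).eval (Sum.elim A fun _ => 0) (x, i) * A (x, j) := by
    intro i j
    simp [qr, eval_bind, eval_ret, hinit, eval_vec, eval_dot]
  refine ⟨?_, fun i i' => ?_, fun x j => ?_⟩
  · simp only [qr, regular_bind, hinit, regular_vec, regular_dot, regular_ret]
    exact ⟨⟨⟨trivial, trivial⟩, hreg⟩, fun _ => trivial, trivial⟩
  · simp only [hQ]
    exact hI.orthonormal i i' i.isLt i'.isLt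
  · simp only [hQ, hR]
    have := congrFun (hI.eq_sum j j.isLt) x
    simp only [Finset.sum_apply, Pi.smul_apply, smul_eq_mul, dotProduct] at this
    rw [this]
    exact Finset.sum_congr rfl fun l _ => mul_comm _ _

end GramSchmidt

/-! ### Correctness of the two QR sweeps. -/

section Orthogonalize

variable {d : ℕ} {n : Fin d → ℕ} {r : Fin (d + 1) → ℕ}

theorem sum_mul_sum_assoc {α β : Type*} [Fintype α] [Fintype β] (L : α → ℝ) (P : α → β → ℝ)
    (Q : β → ℝ) : ∑ a, L a * ∑ b, P a b * Q b = ∑ b, (∑ a, L a * P a b) * Q b := by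
  simp only [Finset.mul_sum, Finset.sum_mul, mul_assoc]
  exact Finset.sum_comm

theorem regular_idMatrix (V : Type) (k : Fin (d + 1)) (x : V → ℝ) :
    (idMatrix r V k).Regular x :=
  ⟨trivial, trivial, trivial⟩

theorem eval_idMatrix (V : Type) (k : Fin (d + 1)) (x : V → ℝ) (b : Fin (r k) × Fin (r k)) :
    (idMatrix r V k).eval x b = if b.1 = b.2 then 1 else 0 := by
  simp only [idMatrix, Prog.eval, Op.eval]
  split_ifs <;> rfl

theorem leftBody_spec (k : Fin d) (hk : k.val + 1 < d) (x : CoreIdx n r → ℝ)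
    (s : Fin (r k.castSucc) × Fin (r k.castSucc) → ℝ)
    (hC : LinearIndependent ℝ fun (b : Fin (r k.succ)) (y : Fin (r k.castSucc) × Fin (n k)) =>
      ∑ a', s (y.1, a') * x ⟨k, a', y.2, b⟩) :
    (leftBody n r k).Regular (Sum.elim x s) ∧
    (∀ b b', ∑ i, ∑ a, (leftBody n r k).eval (Sum.elim x s) (.inr (a, i, b)) *
      (leftBody n r k).eval (Sum.elim x s) (.inr (a, i, b')) = if b = b' then 1 else 0) ∧
    ∀ a i b, ∑ c, (leftBody n r k).eval (Sum.elim x s) (.inr (a, i, c)) *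
      (leftBody n r k).eval (Sum.elim x s) (.inl (c, b)) = ∑ a', s (a, a') * x ⟨k, a', i, b⟩ := by
  let C : (Fin (r k.castSucc) × Fin (n k)) × Fin (r k.succ) → ℝ := fun y =>
    ∑ a', s (y.1.1, a') * x ⟨k, a', y.1.2, y.2⟩
  obtain ⟨h1, h2, h3⟩ := Prog.qr_spec C hC
  have e : ∀ z, (leftBody n r k).eval (Sum.elim x s) z = (Prog.qr _ _).eval C
      (Sum.map id (fun x => ((x.1, x.2.1), x.2.2)) z) := by
    intro z
    rw [leftBody, Prog.eval_bind, if_pos hk, Prog.eval_outMap, Prog.eval_rename]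
    simp only [Function.comp_def, Sum.elim_inr, Prog.eval_vec, Prog.eval_dot, Sum.elim_inl]
    rfl
  refine ⟨?_, fun b b' => ?_, fun a i b => ?_⟩
  · rw [leftBody, Prog.regular_bind, if_pos hk, Prog.regular_outMap, Prog.regular_rename,
      Prog.regular_vec]
    refine ⟨fun _ => Prog.regular_dot _ _ _, ?_⟩
    simp only [Function.comp_def, Sum.elim_inr, Prog.eval_vec, Prog.eval_dot, Sum.elim_inl]
    exact h1
  · simp only [e]
    rw [← h2 b b', Fintype.sum_prod_type, Finset.sum_comm]
    rfl
  · simp only [e]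
    exact h3 (a, i) b

theorem regular_leftBody_last (k : Fin d) (hk : ¬ k.val + 1 < d)
    (x : CoreIdx n r ⊕ (Fin (r k.castSucc) × Fin (r k.castSucc)) → ℝ) :
    (leftBody n r k).Regular x := by
  rw [leftBody, Prog.regular_bind, if_neg hk, Prog.regular_bind, Prog.regular_vec]
  exact ⟨fun _ => Prog.regular_dot _ _ _, regular_idMatrix _ _ _, trivial⟩

theorem rightBody_spec (k : Fin d) (hk : 0 < k.val) (x : CoreIdx n r → ℝ)
    (s : Fin (r k.succ) × Fin (r k.succ) → ℝ)
    (hC : LinearIndependent ℝ fun (a : Fin (r k.castSucc)) (y : Fin (n k) × Fin (r k.succ)) =>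
      ∑ b', x ⟨k, a, y.1, b'⟩ * s (b', y.2)) :
    (rightBody n r k).Regular (Sum.elim x s) ∧
    (∀ a a', ∑ i, ∑ b, (rightBody n r k).eval (Sum.elim x s) (.inr (a, i, b)) *
      (rightBody n r k).eval (Sum.elim x s) (.inr (a', i, b)) = if a = a' then 1 else 0) ∧
    ∀ a i b, ∑ c, (rightBody n r k).eval (Sum.elim x s) (.inl (a, c)) *
      (rightBody n r k).eval (Sum.elim x s) (.inr (c, i, b)) =
        ∑ b', x ⟨k, a, i, b'⟩ * s (b', b) := by
  let C : (Fin (n k) × Fin (r k.succ)) × Fin (r k.castSucc) → ℝ := fun y =>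
    ∑ b', x ⟨k, y.2, y.1.1, b'⟩ * s (b', y.1.2)
  obtain ⟨h1, h2, h3⟩ := Prog.qr_spec C hC
  have e : ∀ z, (rightBody n r k).eval (Sum.elim x s) z = (Prog.qr _ _).eval C
      (Sum.map Prod.swap (fun x => ((x.2.1, x.2.2), x.1)) z) := by
    intro z
    rw [rightBody, Prog.eval_bind, if_pos hk, Prog.eval_outMap, Prog.eval_rename]
    simp only [Function.comp_def, Sum.elim_inr, Prog.eval_vec, Prog.eval_dot, Sum.elim_inl]
    rfl
  refine ⟨?_, fun a a' => ?_, fun a i b => ?_⟩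
  · rw [rightBody, Prog.regular_bind, if_pos hk, Prog.regular_outMap, Prog.regular_rename,
      Prog.regular_vec]
    refine ⟨fun _ => Prog.regular_dot _ _ _, ?_⟩
    simp only [Function.comp_def, Sum.elim_inr, Prog.eval_vec, Prog.eval_dot, Sum.elim_inl]
    exact h1
  · simp only [e]
    rw [← h2 a a', Fintype.sum_prod_type]
    rfl
  · simp only [e]
    refine Eq.trans ?_ (h3 (i, b) a)
    exact Finset.sum_congr rfl fun c _ => mul_comm _ _

theorem regular_rightBody_first (k : Fin d) (hk : ¬ 0 < k.val)
    (x : CoreIdx n r ⊕ (Fin (r k.succ) × Fin (r k.succ)) → ℝ) :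
    (rightBody n r k).Regular x := by
  rw [rightBody, Prog.regular_bind, if_neg hk, Prog.regular_bind, Prog.regular_vec]
  exact ⟨fun _ => Prog.regular_dot _ _ _, regular_idMatrix _ _ _, trivial⟩

/-- The left-to-right sweep yields left-orthogonal cores and the factors that relate the left
interfaces. -/
theorem leftSweep_spec (hn : ∀ k, 1 ≤ n k) (h0 : r 0 = 1) (G : CoreIdx n r → ℝ)
    (hG : tt G ∈ ttManifold n r) :
    ∃ (L : ∀ k : Fin (d + 1), Fin (r k) × Fin (r k) → ℝ) (U : CoreIdx n r → ℝ),
      let P := Prog.sweepRight d (fun k => Fin (r k) × Fin (r k))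
        (fun k => Fin (r k.castSucc) × Fin (n k) × Fin (r k.succ)) (idMatrix r _ 0) (leftBody n r)
      P.eval G = Sum.elim (fun s => L s.1 s.2) U ∧ P.Regular G ∧
      (∀ k : Fin d, k.val + 1 < d → LeftOrthogonal U k) ∧
      ∀ k : Fin (d + 1), k.val < d → ∀ i b,
        ∑ a, leftInterface U k i a * L k (a, b) = leftInterface G k i b := by
  obtain ⟨L, U, h, hinit, hbody, hreg⟩ := Prog.sweepRight_spec G d
    (fun k => Fin (r k) × Fin (r k))
    (fun k => Fin (r k.castSucc) × Fin (n k) × Fin (r k.succ)) (idMatrix r _ 0) (leftBody n r)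
  -- The invariant at bond `k` is a hypothesis here since it is proved together with this: it gives
  -- independent columns at `k`, and QR at `k` gives the invariant at `k + 1`. If the matrix `L k G
  -- k` kills `v`, so does the left interface of `G` at bond `k + 1`, which is injective by the rank
  -- condition.
  have indep : ∀ k : Fin d, k.val + 1 < d →
      (∀ i b, ∑ a, leftInterface (fun x : CoreIdx n r => U x.1 x.2) k.castSucc i a *
        L k.castSucc (a, b) = leftInterface G k.castSucc i b) →
      LinearIndependent ℝ fun (b : Fin (r k.succ)) (y : Fin (r k.castSucc) × Fin (n k)) =>
        ∑ a', L k.castSucc (y.1, a') * G ⟨k, a', y.2, b⟩ := by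
    intro k hk hinv
    rw [Fintype.linearIndependent_iff]
    intro v hv
    refine congrFun (leftInterface_injective hn G k.succ
      (hG k.succ (Fin.succ_ne_zero k) fun hl => ?_) v fun i => ?_)
    · have := congrArg Fin.val hl
      simp at this
      omega
    · simp only [leftInterface_succ, ← hinv, ← sum_mul_sum_assoc]
      refine Finset.sum_eq_zero fun a _ => mul_eq_zero_of_right _ ?_
      have := congrFun hv (a, i k)
      simp only [Finset.sum_apply, Pi.smul_apply, smul_eq_mul, Pi.zero_apply] at this
      rw [sum_mul_sum_assoc]
      exact (Finset.sum_congr rfl fun b _ => mul_comm _ _).trans this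
  -- The last bond is excluded, because no QR decomposition is made at position `d - 1`.
  have hinv : ∀ k : Fin (d + 1), k.val < d → ∀ i b,
      ∑ a, leftInterface (fun x : CoreIdx n r => U x.1 x.2) k i a * L k (a, b) =
        leftInterface G k i b := by
    intro k
    induction k using Fin.induction with
    | zero =>
      intro _ i b
      have : Unique (Fin (r 0)) := by rw [h0]; infer_instance
      rw [Fintype.sum_unique, leftInterface_zero, leftInterface_zero, hinit, eval_idMatrix,
        if_pos (Subsingleton.elim _ _), one_mul]
    | succ k ih =>
      intro hk i b
      have ih' := ih (by simp at hk ⊢)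
      have hk' : k.val + 1 < d := by simpa using hk
      have hb := (leftBody_spec k hk' G (L k.castSucc) (indep k hk' ih')).2.2
      rw [hbody k] at hb
      simp only [Sum.elim_inl, Sum.elim_inr] at hb
      simp only [leftInterface_succ, ← ih']
      rw [← sum_mul_sum_assoc, ← sum_mul_sum_assoc]
      exact Finset.sum_congr rfl fun a _ => congrArg _ (hb a (i k) b)
  refine ⟨L, fun x => U x.1 x.2, h, hreg (regular_idMatrix _ _ _) fun k => ?_, fun k hk => ?_, hinv⟩
  · by_cases hk : k.val + 1 < d
    · exact (leftBody_spec k hk G _ (indep k hk (hinv _ (by simp)))).1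
    · exact regular_leftBody_last k hk _
  · have := (leftBody_spec k hk G _ (indep k hk (hinv _ (by simp)))).2.1
    rw [hbody k] at this
    exact this

/-- The right-to-left sweep yields right-orthogonal cores and the factors that relate the right
interfaces. -/
theorem rightSweep_spec (hn : ∀ k, 1 ≤ n k) (h1 : r (Fin.last d) = 1) (G : CoreIdx n r → ℝ)
    (hG : tt G ∈ ttManifold n r) :
    ∃ (L : ∀ k : Fin (d + 1), Fin (r k) × Fin (r k) → ℝ) (V : CoreIdx n r → ℝ),
      let P := Prog.sweepLeft d (fun k => Fin (r k) × Fin (r k))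
        (fun k => Fin (r k.castSucc) × Fin (n k) × Fin (r k.succ)) (idMatrix r _ (Fin.last d))
        (rightBody n r)
      P.eval G = Sum.elim (fun s => L s.1 s.2) V ∧ P.Regular G ∧
      (∀ k : Fin d, 0 < k.val → RightOrthogonal V k) ∧
      ∀ k : Fin (d + 1), 0 < k.val → ∀ i a,
        ∑ b, L k (a, b) * rightInterface V k i b = rightInterface G k i a := by
  obtain ⟨L, V, h, hinit, hbody, hreg⟩ := Prog.sweepLeft_spec G d
    (fun k => Fin (r k) × Fin (r k))
    (fun k => Fin (r k.castSucc) × Fin (n k) × Fin (r k.succ)) (idMatrix r _ (Fin.last d))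
    (rightBody n r)
  have indep : ∀ k : Fin d, 0 < k.val →
      (∀ i a, ∑ b, L k.succ (a, b) * rightInterface (fun x : CoreIdx n r => V x.1 x.2) k.succ i b =
        rightInterface G k.succ i a) →
      LinearIndependent ℝ fun (a : Fin (r k.castSucc)) (y : Fin (n k) × Fin (r k.succ)) =>
        ∑ b', G ⟨k, a, y.1, b'⟩ * L k.succ (b', y.2) := by
    intro k hk hinv
    rw [Fintype.linearIndependent_iff]
    intro v hv
    refine congrFun (rightInterface_injective hn G k.castSucc
      (hG k.castSucc (fun hl => ?_) (Fin.castSucc_lt_last k).ne) v fun i => ?_)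
    · have := congrArg Fin.val hl
      simp at this
      omega
    · simp only [rightInterface_castSucc, ← hinv, sum_mul_sum_assoc]
      refine Finset.sum_eq_zero fun b _ => mul_eq_zero_of_left ?_ _
      have := congrFun hv (i k, b)
      simpa only [Finset.sum_apply, Pi.smul_apply, smul_eq_mul, Pi.zero_apply,
        sum_mul_sum_assoc] using this
  have hinv : ∀ k : Fin (d + 1), 0 < k.val → ∀ i a,
      ∑ b, L k (a, b) * rightInterface (fun x : CoreIdx n r => V x.1 x.2) k i b =
        rightInterface G k i a := by
    intro k
    induction k using Fin.reverseInduction with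
    | last =>
      intro _ i a
      have : Unique (Fin (r (Fin.last d))) := by rw [h1]; infer_instance
      rw [Fintype.sum_unique, rightInterface_last, rightInterface_last, hinit, eval_idMatrix,
        if_pos (Subsingleton.elim _ _), one_mul]
    | cast k ih =>
      intro hk i a
      have ih' := ih (by simp)
      have hk' : 0 < k.val := by simpa using hk
      have hb := (rightBody_spec k hk' G (L k.succ) (indep k hk' ih')).2.2
      rw [hbody k] at hb
      simp only [Sum.elim_inl, Sum.elim_inr] at hb
      simp only [rightInterface_castSucc, ← ih']
      rw [sum_mul_sum_assoc, sum_mul_sum_assoc]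
      exact Finset.sum_congr rfl fun b _ => congrArg (· * _) (hb a (i k) b)
  refine ⟨L, fun x => V x.1 x.2, h, hreg (regular_idMatrix _ _ _) fun k => ?_, fun k hk => ?_, hinv⟩
  · by_cases hk : 0 < k.val
    · exact (rightBody_spec k hk G _ (indep k hk (hinv _ (by simp)))).1
    · exact regular_rightBody_first k hk _
  · have := (rightBody_spec k hk G _ (indep k hk (hinv _ (by simp)))).2.1
    rw [hbody k] at this
    exact this

/-- The core `S k` is `G k` between the left factor and the right factor. These turn the interfaces
of `U` and `V` into those of `G`, so every mixed train represents the tensor of `G`. -/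
theorem orthogonalize_spec (hn : ∀ k, 1 ≤ n k) (h0 : r 0 = 1) (h1 : r (Fin.last d) = 1)
    (G : CoreIdx n r → ℝ) (hG : tt G ∈ ttManifold n r) :
    (orthogonalize n r).Regular G ∧ IsOrthogonalization (tt G)
      (fun x => (orthogonalize n r).eval G (.U x)) (fun x => (orthogonalize n r).eval G (.S x))
      (fun x => (orthogonalize n r).eval G (.V x)) := by
  obtain ⟨L, U, hU, hUr, hUo, hUi⟩ := leftSweep_spec hn h0 G hG
  obtain ⟨R, V, hV, hVr, hVo, hVi⟩ := rightSweep_spec hn h1 G hG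
  have eU : (fun x => (orthogonalize n r).eval G (.U x)) = U := by
    funext x
    simp only [orthogonalize, Prog.eval_bind, Prog.eval_ret, Sum.elim_inl, Sum.elim_inr, hU]
  have eV : (fun x => (orthogonalize n r).eval G (.V x)) = V := by
    funext x
    simp only [orthogonalize, Prog.eval_bind, Prog.eval_ret, Sum.elim_inl, Sum.elim_inr,
      Prog.eval_rename, Sum.elim_comp_inl, hV]
  have eS : (fun x => (orthogonalize n r).eval G (.S x)) = fun x =>
      ∑ b, (∑ a, L x.1.castSucc (x.2.1, a) * G ⟨x.1, a, x.2.2.1, b⟩) *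
        R x.1.succ (b, x.2.2.2) := by
    funext x
    simp only [orthogonalize, Prog.eval_bind, Prog.eval_ret, Sum.elim_inl, Sum.elim_inr,
      Prog.eval_rename, Sum.elim_comp_inl, hV, hU, Prog.eval_vec, Prog.eval_dot]
  rw [eU, eV, eS]
  refine ⟨?_, hUo, hVo, fun k => ?_⟩
  · simp only [orthogonalize, Prog.regular_bind, Prog.regular_rename, Prog.regular_vec,
      Prog.regular_dot, Sum.elim_comp_inl, Prog.regular_ret, implies_true, and_true]
    exact ⟨hUr, hVr⟩
  · ext i
    rw [tt_mix_apply, tt_apply_core G k]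
    have e₁ := sum_mul_sum_mul' (leftInterface U k.castSucc i)
      (fun a b => ∑ a', L k.castSucc (a, a') * G ⟨k, a', i k, b⟩) (fun b c => R k.succ (b, c))
      (rightInterface V k.succ i)
    have e₂ := sum_mul_sum_mul (leftInterface U k.castSucc i)
      (fun a a' => L k.castSucc (a, a')) (fun a b => G ⟨k, a, i k, b⟩)
      (rightInterface G k.succ i)
    simp only [hVi k.succ (by simp)] at e₁
    simp only [hUi k.castSucc (by simp)] at e₂
    exact e₁.trans e₂

end Orthogonalize

/-! ### Directional derivatives in `R` with the other variables fixed. -/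

section Variables

variable {I : Type}

/-- Assignments of values to the variables of `g`. -/
def GVar.values (R U V : I → ℝ) : GVar I → ℝ
  | .R x => R x
  | .U x => U x
  | .V x => V x

def GVar.equivSum (I : Type) : GVar I ≃ I ⊕ I ⊕ I where
  toFun
    | .R x => .inl x
    | .U x => .inr (.inl x)
    | .V x => .inr (.inr x)
  invFun := Sum.elim .R (Sum.elim .U .V)
  left_inv v := by cases v <;> rfl
  right_inv v := by rcases v with v | v | v <;> rfl

def WVar.equivSum (I : Type) : WVar I ≃ I ⊕ I ⊕ I ⊕ I where
  toFun
    | .R x => .inl x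
    | .U x => .inr (.inl x)
    | .V x => .inr (.inr (.inl x))
    | .Z x => .inr (.inr (.inr x))
  invFun := Sum.elim .R (Sum.elim .U (Sum.elim .V .Z))
  left_inv v := by cases v <;> rfl
  right_inv v := by rcases v with v | v | v | v <;> rfl

instance [Fintype I] : Fintype (GVar I) := Fintype.ofEquiv _ (GVar.equivSum I).symm

instance [Fintype I] : Fintype (WVar I) := Fintype.ofEquiv _ (WVar.equivSum I).symm

/-- The gradient of a program with inputs `R`, `U`, `V` is its derivative along lines in `R`. -/
theorem Prog.hasDerivAt_GVar [Fintype I] (p : Prog (GVar I) Unit) (R U V H : I → ℝ)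
    (hp : p.Regular (GVar.values R U V)) :
    HasDerivAt (fun s : ℝ => p.eval (GVar.values (R + s • H) U V) ())
      (∑ x, p.grad.eval (GVar.values R U V) (.R x) * H x) 0 := by
  -- Stop-gradient for `U` and `V` means zero velocity in these variables.
  have h := p.hasDerivAt_eval (fun s => GVar.values (R + s • H) U V) (GVar.values H 0 0) 0
    (by
      rintro (x | x | x)
      · simpa [GVar.values] using ((hasDerivAt_id (0 : ℝ)).mul_const (H x)).const_add (R x)
      · exact hasDerivAt_const _ _
      · exact hasDerivAt_const _ _) (by simpa using hp)
  refine h.congr_deriv ?_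
  rw [← (GVar.equivSum I).symm.sum_comp]
  simp [Fintype.sum_sum_type, GVar.equivSum, GVar.values]

/-- The gradient of a program with inputs `R`, `U`, `V`, `Z` is its derivative along lines in
`R`. -/
theorem Prog.hasDerivAt_WVar [Fintype I] (p : Prog (WVar I) Unit) (R U V Z H : I → ℝ)
    (hp : p.Regular (WVar.values R U V Z)) :
    HasDerivAt (fun s : ℝ => p.eval (WVar.values (R + s • H) U V Z) ())
      (∑ x, p.grad.eval (WVar.values R U V Z) (.R x) * H x) 0 := by
  have h := p.hasDerivAt_eval (fun s => WVar.values (R + s • H) U V Z) (WVar.values H 0 0 0) 0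
    (by
      rintro (x | x | x | x)
      · simpa [WVar.values] using ((hasDerivAt_id (0 : ℝ)).mul_const (H x)).const_add (R x)
      · exact hasDerivAt_const _ _
      · exact hasDerivAt_const _ _
      · exact hasDerivAt_const _ _) (by simpa using hp)
  refine h.congr_deriv ?_
  rw [← (WVar.equivSum I).symm.sum_comp]
  simp [Fintype.sum_sum_type, WVar.equivSum, WVar.values]

end Variables

/-! ### Derivative of the gradient and symmetry of the Hessian. -/

section Gradient

variable {E : Type*} [NormedAddCommGroup E] [InnerProductSpace ℝ E] [CompleteSpace E]

/-- The inverse of the Riesz map of a real Hilbert space as a linear map. -/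
def rieszInv (E : Type*) [NormedAddCommGroup E] [InnerProductSpace ℝ E] [CompleteSpace E] :
    (E →L[ℝ] ℝ) →L[ℝ] E where
  toFun := (InnerProductSpace.toDual ℝ E).symm
  map_add' := map_add _
  map_smul' c φ := by simp
  cont := (InnerProductSpace.toDual ℝ E).symm.continuous

theorem hasFDerivAt_gradient {f : E → ℝ} {x : E} (hf : ContDiffAt ℝ 2 f x) :
    HasFDerivAt (gradient f) ((rieszInv E).comp (fderiv ℝ (fderiv ℝ f) x)) x := by
  have h : DifferentiableAt ℝ (fderiv ℝ f) x :=
    (hf.fderiv_right (m := 1) (by norm_num)).differentiableAt (by norm_num)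
  exact (rieszInv E).hasFDerivAt.comp x h.hasFDerivAt

theorem inner_fderiv_gradient_comm {f : E → ℝ} {x : E} (hf : ContDiffAt ℝ 2 f x) (v w : E) :
    ⟪fderiv ℝ (gradient f) x v, w⟫_ℝ = ⟪fderiv ℝ (gradient f) x w, v⟫_ℝ := by
  rw [(hasFDerivAt_gradient hf).fderiv]
  have e : ∀ v w, ⟪((rieszInv E).comp (fderiv ℝ (fderiv ℝ f) x)) v, w⟫_ℝ =
      fderiv ℝ (fderiv ℝ f) x v w := fun v w => InnerProductSpace.toDual_symm_apply
  rw [e, e]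
  exact hf.isSymmSndFDerivAt (by simp) v w

end Gradient

/-! ### The gauge projection, the functions `g` and `w`, and the output of the algorithm. -/

section Correctness

variable {d : ℕ} {n : Fin d → ℕ} {r : Fin (d + 1) → ℕ}

/-- The orthogonal projection of delta terms to those satisfying the gauge conditions. -/
def gaugeProj (U D : CoreIdx n r → ℝ) (x : CoreIdx n r) : ℝ :=
  if x.1.val + 1 < d then
    D x - ∑ b, U ⟨x.1, x.2.1, x.2.2.1, b⟩ * ∑ y : Fin (r x.1.castSucc) × Fin (n x.1),
      U ⟨x.1, y.1, y.2, b⟩ * D ⟨x.1, y.1, y.2, x.2.2.2⟩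
  else D x

theorem eval_gaugeProg (x : CoreIdx n r ⊕ CoreIdx n r → ℝ) (y : CoreIdx n r) :
    (gaugeProg n r).eval x y = gaugeProj (fun y => x (.inr y)) (fun y => x (.inl y)) y := by
  simp only [gaugeProg, Prog.eval_bind, Prog.eval_vec, gaugeProj]
  split_ifs with h
  · simp [Prog.eval_bind, Prog.eval_vec, Prog.eval_dot, Prog.eval_op, Op.eval, h]
  · simp [Prog.eval_ret]

theorem regular_gaugeProg (x : CoreIdx n r ⊕ CoreIdx n r → ℝ) : (gaugeProg n r).Regular x := by
  simp only [gaugeProg, Prog.regular_bind, Prog.regular_vec]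
  refine ⟨fun m => ?_, fun y => ?_⟩
  · split_ifs
    · exact Prog.regular_dot _ _ _
    · exact ⟨trivial, trivial⟩
  · split_ifs
    · rw [Prog.regular_bind]
      exact ⟨Prog.regular_dot _ _ _, trivial, trivial⟩
    · trivial

/-- Since `UᵀU = 1`, `Uᵀ (D - U Uᵀ D) = 0`. -/
theorem gauge_gaugeProj {U : CoreIdx n r → ℝ}
    (hU : ∀ k : Fin d, k.val + 1 < d → LeftOrthogonal U k) (D : CoreIdx n r → ℝ) :
    Gauge U (gaugeProj U D) := by
  intro k hk b b'
  let M (c : Fin (r k.succ)) : ℝ :=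
    ∑ y : Fin (r k.castSucc) × Fin (n k), U ⟨k, y.1, y.2, c⟩ * D ⟨k, y.1, y.2, b'⟩
  have e : ∀ a i, gaugeProj U D ⟨k, a, i, b'⟩ = D ⟨k, a, i, b'⟩ - ∑ c, U ⟨k, a, i, c⟩ * M c :=
    fun a i => if_pos hk
  have e₂ : ∑ c, (∑ i, ∑ a, U ⟨k, a, i, b⟩ * U ⟨k, a, i, c⟩) * M c = M b := by
    simp only [hU k hk b, ite_mul, one_mul, zero_mul]
    exact (Finset.sum_ite_eq _ _ _).trans (if_pos (Finset.mem_univ _))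
  simp only [e, mul_sub, Finset.sum_sub_distrib]
  rw [sub_eq_zero]
  trans M b
  · rw [Finset.sum_comm]
    exact (Fintype.sum_prod_type fun y : Fin (r k.castSucc) × Fin (n k) =>
      U ⟨k, y.1, y.2, b⟩ * D ⟨k, y.1, y.2, b'⟩).symm
  · rw [← e₂]
    simp only [Finset.sum_mul, Finset.mul_sum]
    rw [Finset.sum_comm]
    refine Finset.sum_congr rfl fun i _ => ?_
    rw [Finset.sum_comm]
    simp only [mul_assoc]

/-- The removed part has the form `U k M`, whose pairing with `δ k` is that of `M` with `U kᵀ δ k =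
0`. -/
theorem sum_gaugeProj_mul {U δ : CoreIdx n r → ℝ} (hδ : Gauge U δ) (D : CoreIdx n r → ℝ) :
    ∑ x, gaugeProj U D x * δ x = ∑ x, D x * δ x := by
  rw [Fintype.sum_sigma, Fintype.sum_sigma]
  refine Finset.sum_congr rfl fun k _ => ?_
  by_cases hk : k.val + 1 < d
  · let M (c b' : Fin (r k.succ)) : ℝ :=
      ∑ y : Fin (r k.castSucc) × Fin (n k), U ⟨k, y.1, y.2, c⟩ * D ⟨k, y.1, y.2, b'⟩
    have e : ∀ y, gaugeProj U D ⟨k, y⟩ =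
      D ⟨k, y⟩ - ∑ c, U ⟨k, y.1, y.2.1, c⟩ * M c y.2.2 := fun y => if_pos hk
    simp only [e, sub_mul, Finset.sum_sub_distrib]
    rw [sub_eq_self]
    have e₂ : ∀ b', ∑ c, M c b' * ∑ i, ∑ a, U ⟨k, a, i, c⟩ * δ ⟨k, a, i, b'⟩ = 0 :=
      fun b' => Finset.sum_eq_zero fun c _ => by rw [hδ k hk, mul_zero]
    rw [← Finset.sum_eq_zero fun b' (_ : b' ∈ Finset.univ) => e₂ b']
    simp only [Fintype.sum_prod_type, Finset.sum_mul, Finset.mul_sum]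
    rw [Finset.sum_comm, Finset.sum_congr rfl fun i _ => Finset.sum_comm, Finset.sum_comm]
    refine Finset.sum_congr rfl fun b' _ => ?_
    rw [Finset.sum_congr rfl fun i _ => Finset.sum_comm, Finset.sum_comm]
    refine Finset.sum_congr rfl fun c _ => Finset.sum_congr rfl fun i _ =>
      Finset.sum_congr rfl fun a _ => ?_
    ring
  · refine Finset.sum_congr rfl fun y _ => ?_
    rw [show gaugeProj U D ⟨k, y⟩ = D ⟨k, y⟩ from if_neg hk]

/-- Orthogonal projection to the tangent space: apply the adjoint of `tangentVector U V`, enforce the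
gauge conditions, and apply `tangentVector U V`. -/
theorem starProjection_eq_tangentVector (h0 : r 0 = 1) (h1 : r (Fin.last d) = 1)
    {U V : CoreIdx n r → ℝ} (hU : ∀ k : Fin d, k.val + 1 < d → LeftOrthogonal U k)
    (hV : ∀ k : Fin d, 0 < k.val → RightOrthogonal V k) {K : Submodule ℝ (Tensor n)}
    (hK : K = LinearMap.range (tangentMap U V)) {Y : Tensor n} {D : CoreIdx n r → ℝ}
    (hD : ∀ H, ∑ x, D x * H x = ⟪Y, tangentVector U V H⟫_ℝ) :
    K.starProjection Y = tangentVector U V (gaugeProj U D) := by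
  refine Submodule.eq_starProjection_of_mem_of_inner_eq_zero ?_ ?_
  · rw [hK]
    exact ⟨_, rfl⟩
  · rw [hK]
    rintro _ ⟨δ, rfl⟩
    -- Test vectors may be taken with gauged delta terms, where `T` is an isometry and the gauge
    -- projection is invisible.
    obtain ⟨δ', hδ', e⟩ := exists_gauge V hU δ
    change ⟪_, tangentVector U V δ⟫_ℝ = 0
    rw [← e, inner_sub_left, ← hD, inner_tangentVector h0 h1 hU hV (gauge_gaugeProj hU D) hδ',
      sum_gaugeProj_mul hδ', sub_self]

/-- The block cores need not have minimal ranks; `Evaluates` covers arbitrary cores of a tensor in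
`D`. -/
theorem eval_gProg (hd : d ≠ 0) {D : Set (Tensor n)} {f : Tensor n → ℝ}
    {p : ∀ r : Fin (d + 1) → ℕ, Prog (CoreIdx n r) Unit} (hp : Evaluates p f D)
    (hr : IsRankVector (doubleRank r)) (R U V : CoreIdx n r → ℝ)
    (h : tangentVector U V R ∈ D) :
    (gProg n r (p (doubleRank r))).Regular (GVar.values R U V) ∧
      (gProg n r (p (doubleRank r))).eval (GVar.values R U V) () = f (tangentVector U V R) := by
  have e := tt_deltasToCores hd (GVar.values R U V)
  obtain ⟨h1, h2⟩ := hp (doubleRank r) hr ((deltasToCores n r).eval (GVar.values R U V))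
    (by rw [e]; exact h)
  rw [gProg, Prog.regular_bind, Prog.eval_bind, Prog.eval_rename, Prog.regular_rename,
    Sum.elim_comp_inr]
  exact ⟨⟨regular_deltasToCores _, h1⟩, by rw [h2, e]; rfl⟩

theorem tangentVector_line (U V R H : CoreIdx n r → ℝ) (s : ℝ) :
    tangentVector U V (R + s • H) = tangentVector U V R + s • tangentVector U V H := by
  rw [tangentVector_add, tangentVector_smul]

theorem eventually_tangentVector_mem {D : Set (Tensor n)} (hD : IsOpen D)
    {U V R : CoreIdx n r → ℝ} (h : tangentVector U V R ∈ D) (H : CoreIdx n r → ℝ) :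
    ∀ᶠ s in nhds (0 : ℝ), tangentVector U V (R + s • H) ∈ D := by
  have hc : Continuous fun s : ℝ => tangentVector U V R + s • tangentVector U V H := by fun_prop
  simp only [tangentVector_line]
  exact hc.continuousAt.eventually_mem (hD.mem_nhds (by simpa using h))

/-- Backpropagation through `g` yields the adjoint of `tangentVector U V` applied to `∇ f`. -/
theorem sum_grad_gProg (hd : d ≠ 0) {D : Set (Tensor n)} (hD : IsOpen D) {f : Tensor n → ℝ}
    {p : ∀ r : Fin (d + 1) → ℕ, Prog (CoreIdx n r) Unit} (hp : Evaluates p f D)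
    (hr : IsRankVector (doubleRank r)) (R U V : CoreIdx n r → ℝ) (h : tangentVector U V R ∈ D)
    (hf : DifferentiableAt ℝ f (tangentVector U V R)) (H : CoreIdx n r → ℝ) :
    ∑ x, (gProg n r (p (doubleRank r))).grad.eval (GVar.values R U V) (.R x) * H x =
      ⟪gradient f (tangentVector U V R), tangentVector U V H⟫_ℝ := by
  have h1 := Prog.hasDerivAt_GVar _ R U V H (eval_gProg hd hp hr R U V h).1
  have h2 : HasDerivAt (fun s : ℝ => f (tangentVector U V (R + s • H)))
      (fderiv ℝ f (tangentVector U V R) (tangentVector U V H)) 0 := by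
    simp only [tangentVector_line]
    exact hf.hasFDerivAt.hasLineDerivAt _
  rw [gradient, InnerProductSpace.toDual_symm_apply]
  refine h1.unique (h2.congr_of_eventuallyEq ?_)
  filter_upwards [eventually_tangentVector_mem hD h H] with s hs
  exact (eval_gProg hd hp hr _ U V hs).2

theorem eval_wProg (p : Prog (CoreIdx n (doubleRank r)) Unit) (R U V Z : CoreIdx n r → ℝ) :
    (wProg n r p).eval (WVar.values R U V Z) () =
      ∑ x, gaugeProj U (fun x => (gProg n r p).grad.eval (GVar.values R U V) (.R x)) x * Z x := by
  have e : (WVar.values R U V Z ∘ fun v : GVar (CoreIdx n r) => match v with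
      | .R x => .R x
      | .U x => .U x
      | .V x => .V x) = GVar.values R U V := by
    funext v
    cases v <;> rfl
  simp only [wProg, Prog.eval_bind, Prog.eval_dot, Prog.eval_rename, Prog.eval_outMap,
    Sum.elim_inr, Sum.elim_inl, eval_gaugeProg]
  rw [← e]
  rfl

theorem regular_wProg (p : Prog (CoreIdx n (doubleRank r)) Unit) (R U V Z : CoreIdx n r → ℝ)
    (h : (gProg n r p).Regular (GVar.values R U V)) :
    (wProg n r p).Regular (WVar.values R U V Z) := by
  have e : (WVar.values R U V Z ∘ fun v : GVar (CoreIdx n r) => match v with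
      | .R x => .R x
      | .U x => .U x
      | .V x => .V x) = GVar.values R U V := by
    funext v
    cases v <;> rfl
  simp only [wProg, Prog.regular_bind, Prog.regular_rename, Prog.regular_outMap]
  exact ⟨Prog.regular_grad _ _ ((congrArg _ e).mpr h), regular_gaugeProg _, Prog.regular_dot _ _ _⟩

/-- Against gauged `δ` the projection inside `w` has no effect, so `w` is a directional derivative
of `f`. This closed form is what gets differentiated a second time. -/
theorem eval_wProg_eq_inner (hd : d ≠ 0) {D : Set (Tensor n)} (hD : IsOpen D) {f : Tensor n → ℝ}
    (hf : ContDiffOn ℝ ∞ f D)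
    {p : ∀ r : Fin (d + 1) → ℕ, Prog (CoreIdx n r) Unit} (hp : Evaluates p f D)
    (hr : IsRankVector (doubleRank r)) (R U V : CoreIdx n r → ℝ) (h : tangentVector U V R ∈ D)
    {δ : CoreIdx n r → ℝ} (hδ : Gauge U δ) :
    (wProg n r (p (doubleRank r))).eval (WVar.values R U V δ) () =
      ⟪gradient f (tangentVector U V R), tangentVector U V δ⟫_ℝ := by
  rw [eval_wProg, sum_gaugeProj_mul hδ, sum_grad_gProg hd hD hp hr R U V h]
  exact (hf.contDiffAt (hD.mem_nhds h)).differentiableAt (by simp)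

/-- Backpropagation through `w` yields the adjoint of `tangentVector U V` applied to `∇² f Z`. -/
theorem sum_grad_wProg (hd : d ≠ 0) {D : Set (Tensor n)} (hD : IsOpen D) {f : Tensor n → ℝ}
    (hf : ContDiffOn ℝ ∞ f D)
    {p : ∀ r : Fin (d + 1) → ℕ, Prog (CoreIdx n r) Unit} (hp : Evaluates p f D)
    (hr : IsRankVector (doubleRank r)) (R U V : CoreIdx n r → ℝ) (h : tangentVector U V R ∈ D)
    {δ : CoreIdx n r → ℝ} (hδ : Gauge U δ) (H : CoreIdx n r → ℝ) :
    ∑ x, (wProg n r (p (doubleRank r))).grad.eval (WVar.values R U V δ) (.R x) * H x =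
      ⟪fderiv ℝ (gradient f) (tangentVector U V R) (tangentVector U V δ),
        tangentVector U V H⟫_ℝ := by
  have hf2 : ContDiffAt ℝ 2 f (tangentVector U V R) :=
    contDiffAt_infty.1 (hf.contDiffAt (hD.mem_nhds h)) 2
  have h1 := Prog.hasDerivAt_WVar _ R U V δ H
    (regular_wProg _ R U V δ (eval_gProg hd hp hr R U V h).1)
  have h2 : HasDerivAt (fun s : ℝ => gradient f (tangentVector U V (R + s • H)))
      (fderiv ℝ (gradient f) (tangentVector U V R) (tangentVector U V H)) 0 := by
    simp only [tangentVector_line]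
    exact (hasFDerivAt_gradient hf2).differentiableAt.hasFDerivAt.hasLineDerivAt _
  have h3 := h2.inner ℝ (hasDerivAt_const (0 : ℝ) (tangentVector U V δ))
  rw [inner_zero_right, zero_add] at h3
  -- Differentiating `w` puts `T H` into the Hessian and pairs with `Z`; symmetry exchanges the two.
  rw [inner_fderiv_gradient_comm hf2]
  refine h1.unique (h3.congr_of_eventuallyEq ?_)
  filter_upwards [eventually_tangentVector_mem hD h H] with s hs
  exact eval_wProg_eq_inner hd hD hf hp hr _ U V hs hδ

/-- Only the first summand survives, and it is the decomposition of `X` centred at `μ = 0`. -/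
theorem tangentVector_first {X : Tensor n} {U S V : CoreIdx n r → ℝ} (hd : d ≠ 0)
    (h : IsOrthogonalization X U S V) :
    tangentVector U V (fun x => if x.1.val = 0 then S x else 0) = X := by
  ext i
  rw [tangentVector_apply, ← h.eq ⟨0, Nat.pos_of_ne_zero hd⟩,
    Finset.sum_eq_single ⟨0, Nat.pos_of_ne_zero hd⟩]
  · simp only [tt_mix_apply, if_true]
  · intro k _ hk
    have : k.val ≠ 0 := fun h => hk (Fin.ext h)
    simp [tt_mix_apply, this]
  · simp

theorem hessProg_spec (hd : d ≠ 0) (p : Prog (CoreIdx n (doubleRank r)) Unit)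
    (G δ : CoreIdx n r → ℝ) {U S V S₀ : CoreIdx n r → ℝ}
    (hU : U = fun x => (orthogonalize n r).eval G (.U x))
    (hS : S = fun x => (orthogonalize n r).eval G (.S x))
    (hV : V = fun x => (orthogonalize n r).eval G (.V x))
    (hS₀ : S₀ = fun x => if x.1.val = 0 then S x else 0) :
    ((orthogonalize n r).Regular G → (wProg n r p).Regular (WVar.values S₀ U V δ) →
      (hessProg n r p).Regular (HessVar.values G δ)) ∧
    tt ((hessProg n r p).eval (HessVar.values G δ)) = tangentVector U V
      (gaugeProj U fun x => (wProg n r p).grad.eval (WVar.values S₀ U V δ) (.R x)) := by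
  have e1 : HessVar.values G δ ∘ HessVar.G = G := rfl
  let y := Sum.elim (HessVar.values G δ) ((orthogonalize n r).eval G)
  let z := Sum.elim y ((Prog.step (.const 0) (.ret (fun x : CoreIdx n r =>
    if x.1.val = 0 then some (.inr (.S x)) else none)) :
      Prog (HessVar (CoreIdx n r) ⊕ OrthVar (CoreIdx n r)) (CoreIdx n r)).eval y)
  have e2 : (z ∘ fun v : WVar (CoreIdx n r) => match v with
      | .R x => .inr x
      | .U x => .inl (.inr (.U x))
      | .V x => .inl (.inr (.V x))
      | .Z x => .inl (.inl (.Z x))) = WVar.values S₀ U V δ := by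
    subst hU hS hV hS₀
    funext v
    cases v with
    | R x =>
      simp only [Function.comp, z, Sum.elim_inr, Prog.eval, WVar.values]
      split_ifs <;> rfl
    | _ => rfl
  constructor
  · intro ho hw
    simp only [hessProg, Prog.regular_bind, Prog.regular_rename, Prog.regular_outMap,
      Prog.eval_rename, e1]
    refine ⟨ho, ⟨trivial, trivial⟩, ?_, regular_gaugeProg _, regular_deltasToCores _⟩
    refine Prog.regular_grad _ _ ?_
    exact (congrArg _ e2).mpr hw
  · simp only [hessProg, Prog.eval_bind, Prog.eval_rename, Prog.eval_outMap, e1]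
    rw [tt_deltasToCores hd]
    simp only [Function.comp_def, Sum.elim_inr, Sum.elim_inl, eval_gaugeProg]
    rw [← e2, hU, hV]
    rfl

end Correctness

/-! ### Costs -/

theorem Prog.cost_vec_le {V ι : Type} [Fintype ι] (p : ι → Prog V Unit) {b : ℕ}
    (h : ∀ i, (p i).cost ≤ b) : (vec p).cost ≤ Fintype.card ι * b := by
  rw [cost_vec]
  exact (Finset.sum_le_card_nsmul _ _ b fun i _ => h i).trans_eq (by simp)

theorem Prog.cost_qr (ι : Type) [Fintype ι] (c : ℕ) :
    (qr ι c).cost = c * (4 * c * Fintype.card ι + 4 * Fintype.card ι + 1) +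
      2 * c * c * Fintype.card ι := by
  simp only [qr, cost_bind, cost, cost_loop, gramSchmidtStep, cost_vec, cost_dot, cost_op,
    Op.cost, Finset.sum_const, Finset.card_univ, Fintype.card_fin, Fintype.card_prod, smul_eq_mul]
  ring

section Cost

variable {d : ℕ} {n : Fin d → ℕ} {r : Fin (d + 1) → ℕ} {N ρ : ℕ}

/-- Here `11 = 6 + 4 + 1`, after the lower-order terms in `ρ` are raised to `N * ρ ^ 3`. -/
theorem cost_qr_le {ι : Type} [Fintype ι] {c : ℕ} (hc : c ≤ ρ) (hι : Fintype.card ι ≤ ρ * N)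
    (hN : 1 ≤ N) (hρ : 1 ≤ ρ) : (Prog.qr ι c).cost ≤ 11 * (N * ρ ^ 3) := by
  rw [Prog.cost_qr]
  calc _ ≤ ρ * (4 * ρ * (ρ * N) + 4 * (ρ * N) + 1) + 2 * ρ * ρ * (ρ * N) := by gcongr
    _ = 6 * (N * ρ ^ 3) + 4 * (N * ρ ^ 2) + 1 * ρ ^ 1 := by ring
    _ ≤ 6 * (N * ρ ^ 3) + 4 * (N * ρ ^ 3) + N * ρ ^ 3 := by
      gcongr <;> first | exact hρ | omega
    _ = 11 * (N * ρ ^ 3) := by ring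

theorem card_core_le (hn : ∀ k, n k ≤ N) (hr : ∀ k, r k ≤ ρ) (k : Fin d) :
    Fintype.card (Fin (r k.castSucc) × Fin (n k) × Fin (r k.succ)) ≤ N * ρ ^ 2 := by
  simp only [Fintype.card_prod, Fintype.card_fin]
  calc _ ≤ ρ * (N * ρ) := by gcongr <;> first | exact hr _ | exact hn _
    _ = _ := by ring

theorem card_coreIdx_le (hn : ∀ k, n k ≤ N) (hr : ∀ k, r k ≤ ρ) :
    Fintype.card (CoreIdx n r) ≤ d * (N * ρ ^ 2) := by
  rw [Fintype.card_sigma]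
  exact (Finset.sum_le_card_nsmul _ _ _ fun k _ => card_core_le hn hr k).trans_eq (by simp)

theorem cost_vec_core_le (hn : ∀ k, n k ≤ N) (hr : ∀ k, r k ≤ ρ) {V : Type} (k : Fin d)
    (p : Fin (r k.castSucc) × Fin (n k) × Fin (r k.succ) → Prog V Unit)
    (hp : ∀ y, (p y).cost ≤ 2 * ρ) : (Prog.vec p).cost ≤ 2 * (N * ρ ^ 3) :=
  calc _ ≤ N * ρ ^ 2 * (2 * ρ) :=
        (Prog.cost_vec_le p hp).trans (Nat.mul_le_mul_right _ (card_core_le hn hr k))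
    _ = _ := by ring

theorem cost_dot_le {V : Type} {k : ℕ} (hk : k ≤ ρ) (a b : Fin k → V) :
    (Prog.dot a b).cost ≤ 2 * ρ := by
  rw [Prog.cost_dot, Fintype.card_fin]
  omega

theorem cost_idMatrix (V : Type) (k : Fin (d + 1)) : (idMatrix r V k).cost = 0 := rfl

theorem cost_leftBody_le (hn : ∀ k, n k ≤ N) (hr : ∀ k, r k ≤ ρ) (hN : 1 ≤ N) (hρ : 1 ≤ ρ)
    (k : Fin d) : (leftBody n r k).cost ≤ 13 * (N * ρ ^ 3) := by
  rw [leftBody, Prog.cost_bind]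
  refine (Nat.add_le_add (d := 11 * (N * ρ ^ 3))
    (cost_vec_core_le hn hr k _ fun y => cost_dot_le (hr _) _ _) ?_).trans_eq (by ring)
  split_ifs
  · rw [Prog.cost_outMap, Prog.cost_rename]
    refine cost_qr_le (hr _) ?_ hN hρ
    rw [Fintype.card_prod, Fintype.card_fin, Fintype.card_fin]
    exact Nat.mul_le_mul (hr _) (hn _)
  · rw [Prog.cost_bind, cost_idMatrix, Prog.cost_ret]
    exact Nat.zero_le _

theorem cost_rightBody_le (hn : ∀ k, n k ≤ N) (hr : ∀ k, r k ≤ ρ) (hN : 1 ≤ N) (hρ : 1 ≤ ρ)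
    (k : Fin d) : (rightBody n r k).cost ≤ 13 * (N * ρ ^ 3) := by
  rw [rightBody, Prog.cost_bind]
  refine (Nat.add_le_add (d := 11 * (N * ρ ^ 3))
    (cost_vec_core_le hn hr k _ fun y => cost_dot_le (hr _) _ _) ?_).trans_eq (by ring)
  split_ifs
  · rw [Prog.cost_outMap, Prog.cost_rename]
    refine cost_qr_le (hr _) ?_ hN hρ
    rw [Fintype.card_prod, Fintype.card_fin, Fintype.card_fin, mul_comm]
    exact Nat.mul_le_mul (hr _) (hn _)
  · rw [Prog.cost_bind, cost_idMatrix, Prog.cost_ret]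
    exact Nat.zero_le _

theorem cost_vec_coreIdx_le (hn : ∀ k, n k ≤ N) (hr : ∀ k, r k ≤ ρ) {V : Type} {c : ℕ}
    (p : CoreIdx n r → Prog V Unit) (hp : ∀ y, (p y).cost ≤ c * ρ) :
    (Prog.vec p).cost ≤ c * (d * (N * ρ ^ 3)) :=
  calc _ ≤ d * (N * ρ ^ 2) * (c * ρ) :=
        (Prog.cost_vec_le p hp).trans (Nat.mul_le_mul_right _ (card_coreIdx_le hn hr))
    _ = _ := by ring

theorem sum_le_mul {b : ℕ} {f : Fin d → ℕ} (h : ∀ k, f k ≤ b) : ∑ k, f k ≤ d * b :=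
  (Finset.sum_le_card_nsmul _ _ b fun k _ => h k).trans_eq (by simp)

theorem cost_orthogonalize_le (hn : ∀ k, n k ≤ N) (hr : ∀ k, r k ≤ ρ) (hN : 1 ≤ N) (hρ : 1 ≤ ρ) :
    (orthogonalize n r).cost ≤ 30 * (d * (N * ρ ^ 3)) := by
  rw [orthogonalize, Prog.cost_bind, Prog.cost_bind, Prog.cost_bind, Prog.cost_bind,
    Prog.cost_rename, Prog.cost_sweepRight, Prog.cost_sweepLeft, cost_idMatrix, cost_idMatrix,
    Prog.cost_ret]
  have h1 := sum_le_mul fun k => cost_leftBody_le hn hr hN hρ k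
  have h2 := sum_le_mul fun k => cost_rightBody_le hn hr hN hρ k
  refine (Nat.add_le_add (Nat.add_le_add le_rfl h1) (Nat.add_le_add (Nat.add_le_add le_rfl h2)
    (Nat.add_le_add (cost_vec_coreIdx_le (c := 2) hn hr _ fun y => cost_dot_le (hr _) _ _)
    (Nat.add_le_add (cost_vec_coreIdx_le (c := 2) hn hr _ fun y => cost_dot_le (hr _) _ _)
      le_rfl)))).trans_eq ?_
  ring

theorem cost_gaugeProg_le (hn : ∀ k, n k ≤ N) (hr : ∀ k, r k ≤ ρ) (hρ : 1 ≤ ρ) :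
    (gaugeProg n r).cost ≤ 5 * (d * (N * ρ ^ 3)) := by
  rw [gaugeProg, Prog.cost_bind]
  have h1 : Fintype.card (Σ k : Fin d, Fin (r k.succ) × Fin (r k.succ)) ≤ d * ρ ^ 2 := by
    rw [Fintype.card_sigma]
    refine sum_le_mul fun k => ?_
    rw [Fintype.card_prod, Fintype.card_fin, pow_two]
    exact Nat.mul_le_mul (hr _) (hr _)
  refine (Nat.add_le_add (Prog.cost_vec_le _ (b := 2 * (ρ * N)) fun m => ?_)
    (cost_vec_coreIdx_le (c := 3) hn hr _ fun y => ?_)).trans ?_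
  · split_ifs
    · rw [Prog.cost_dot, Fintype.card_prod, Fintype.card_fin, Fintype.card_fin]
      exact Nat.mul_le_mul_left _ (Nat.mul_le_mul (hr _) (hn _))
    · exact Nat.zero_le _
  · split_ifs
    · rw [Prog.cost_bind]
      change _ + 1 ≤ _
      have := cost_dot_le (V := (CoreIdx n r ⊕ CoreIdx n r) ⊕
        (Σ k : Fin d, Fin (r k.succ) × Fin (r k.succ))) (hr y.1.succ)
        (fun b => .inl (.inr ⟨y.1, y.2.1, y.2.2.1, b⟩)) (fun b => .inr ⟨y.1, b, y.2.2.2⟩)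
      omega
    · exact Nat.zero_le _
  · calc _ ≤ d * ρ ^ 2 * (2 * (ρ * N)) + 3 * (d * (N * ρ ^ 3)) := by gcongr
      _ = _ := by ring

theorem cost_wProg_le (hn : ∀ k, n k ≤ N) (hr : ∀ k, r k ≤ ρ) (hρ : 1 ≤ ρ)
    (p : Prog (CoreIdx n (doubleRank r)) Unit) :
    (wProg n r p).cost ≤ 6 * p.cost + 7 * (d * (N * ρ ^ 3)) := by
  have h1 : (gProg n r p).cost = p.cost := by
    rw [gProg, Prog.cost_bind, Prog.cost_rename]
    exact Nat.zero_add _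
  have h2 := (gProg n r p).cost_grad
  have h3 := cost_gaugeProg_le hn hr hρ
  have h4 : Fintype.card (CoreIdx n r) ≤ d * (N * ρ ^ 3) :=
    (card_coreIdx_le hn hr).trans (by gcongr; first | exact hρ | omega)
  rw [wProg, Prog.cost_bind, Prog.cost_bind, Prog.cost_rename, Prog.cost_rename, Prog.cost_outMap,
    Prog.cost_dot]
  omega

/-- `36 = 6 · 6` from the nested gradients; `77 = 30 + 6 · 7 + 5` from orthogonalization, the
overhead of `w` under its gradient, and the final gauge projection. -/
theorem cost_hessProg_le (hn : ∀ k, n k ≤ N) (hr : ∀ k, r k ≤ ρ) (hN : 1 ≤ N) (hρ : 1 ≤ ρ)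
    (p : Prog (CoreIdx n (doubleRank r)) Unit) :
    (hessProg n r p).cost ≤ 36 * p.cost + 77 * (d * (N * ρ ^ 3)) := by
  have h1 := cost_orthogonalize_le hn hr hN hρ
  have h2 := (wProg n r p).cost_grad
  have h3 := cost_gaugeProg_le hn hr hρ
  have h4 := cost_wProg_le hn hr hρ p
  have h5 : (deltasToCores n r).cost = 0 := rfl
  rw [hessProg, Prog.cost_bind, Prog.cost_bind, Prog.cost_bind, Prog.cost_bind, Prog.cost_rename,
    Prog.cost_rename, Prog.cost_rename, Prog.cost_rename, Prog.cost_outMap, h5, Prog.cost,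
    Prog.cost_ret, Op.cost]
  omega

theorem isRankVector_doubleRank (hr : IsRankVector r) : IsRankVector (doubleRank r) := by
  refine ⟨?_, ?_, fun k => ?_⟩
  · simpa [doubleRank] using hr.1
  · simpa [doubleRank] using hr.2.1
  · have := hr.2.2 k
    rw [doubleRank]
    split_ifs <;> omega

theorem doubleRank_le (k : Fin (d + 1)) : doubleRank r k ≤ 2 * r k := by
  rw [doubleRank]
  split_ifs <;> omega

/-- Each monomial grows by at most 2 to its degree, and nonnegative coefficients allow a comparison
term by term. -/
theorem eval_doubleRank_le {q : ℕ} (P : MvPolynomial (Fin (d + 1)) ℝ) (hq : P.totalDegree ≤ q)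
    (hP : ∀ m, 0 ≤ P.coeff m) :
    MvPolynomial.eval (fun k => (doubleRank r k : ℝ)) P ≤
      2 ^ q * MvPolynomial.eval (fun k => (r k : ℝ)) P := by
  rw [MvPolynomial.eval_eq', MvPolynomial.eval_eq', Finset.mul_sum]
  refine Finset.sum_le_sum fun m hm => ?_
  rw [mul_left_comm]
  refine mul_le_mul_of_nonneg_left ?_ (hP m)
  have hdeg : ∑ k, m k ≤ q := by
    have := MvPolynomial.le_totalDegree hm
    rw [Finsupp.sum_fintype _ _ fun _ => rfl] at this
    exact this.trans hq
  calc ∏ k, (doubleRank r k : ℝ) ^ m k ≤ ∏ k, (2 * (r k : ℝ)) ^ m k := by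
        gcongr with k
        exact_mod_cast doubleRank_le k
    _ = 2 ^ (∑ k, m k) * ∏ k, (r k : ℝ) ^ m k := by
        simp only [mul_pow, Finset.prod_mul_distrib, Finset.prod_pow_eq_pow_sum]
    _ ≤ 2 ^ q * ∏ k, (r k : ℝ) ^ m k := by
        gcongr
        norm_num

/-- Doubling the ranks multiplies a cost that is polynomial in the ranks by a constant. -/
theorem PolynomialInRanks.doubleRank_le {q : ℕ} {K : ℝ} {F : (Fin (d + 1) → ℕ) → ℝ}
    (hF : PolynomialInRanks q K F) (hr : IsRankVector r) :
    0 ≤ F r ∧ F (doubleRank r) ≤ |K| * 2 ^ q * F r := by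
  obtain ⟨P, hq, hP, h⟩ := hF
  have nonneg : ∀ s : Fin (d + 1) → ℕ, 0 ≤ MvPolynomial.eval (fun k => (s k : ℝ)) P := by
    intro s
    rw [MvPolynomial.eval_eq']
    exact Finset.sum_nonneg fun m _ => mul_nonneg (hP m) (Finset.prod_nonneg fun k _ => by positivity)
  refine ⟨(nonneg r).trans (h r hr).1, ?_⟩
  calc F (doubleRank r) ≤ K * MvPolynomial.eval (fun k => (doubleRank r k : ℝ)) P :=
        (h _ (isRankVector_doubleRank hr)).2
    -- The sign of `K` is not assumed; the absolute value makes the later monotonicity steps valid.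
    _ ≤ |K| * MvPolynomial.eval (fun k => (doubleRank r k : ℝ)) P :=
        mul_le_mul_of_nonneg_right (le_abs_self K) (nonneg _)
    _ ≤ |K| * (2 ^ q * F r) := by
        gcongr
        refine (eval_doubleRank_le P hq hP).trans ?_
        gcongr
        exact (h r hr).1
    _ = |K| * 2 ^ q * F r := by ring

/-- For `d ≥ 2` the bond 1 is an inner one, so the maximum is at least 1 and also dominates the
outer ranks. -/
theorem le_maxRank (hd : 2 ≤ d) (hr : IsRankVector r) :
    1 ≤ maxRank r ∧ ∀ k, r k ≤ maxRank r := by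
  have inner : ∀ k : Fin (d + 1), k ≠ 0 ∧ k ≠ Fin.last d → r k ≤ maxRank r := fun k hk =>
    Finset.le_sup (f := r) (Finset.mem_filter.2 ⟨Finset.mem_univ k, hk⟩)
  have one : 1 ≤ maxRank r := by
    refine (hr.2.2 ⟨1, by omega⟩).trans (inner _ ⟨fun h => ?_, fun h => ?_⟩)
    · simpa using congrArg Fin.val h
    · have := congrArg Fin.val h
      simp at this
      omega
  refine ⟨one, fun k => ?_⟩
  by_cases h0 : k = 0
  · rw [h0, hr.1]
    exact one
  · by_cases h1 : k = Fin.last d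
    · rw [h1, hr.2.1]
      exact one
    · exact inner k ⟨h0, h1⟩

theorem cost_hessProg_le_of_polynomialInRanks {q : ℕ} {K : ℝ} (hd : 2 ≤ d) (hn : ∀ k, 1 ≤ n k)
    {p : ∀ r : Fin (d + 1) → ℕ, Prog (CoreIdx n r) Unit} {F : (Fin (d + 1) → ℕ) → ℝ}
    (hF : PolynomialInRanks q K F) (hp : ∀ r, IsRankVector r → ((p r).cost : ℝ) ≤ F r)
    (hr : IsRankVector r) :
    ((hessProg n r (p (doubleRank r))).cost : ℝ) ≤
      (36 * (|K| * 2 ^ q) + 77) * (F r + (d : ℝ) * (maxMode n : ℝ) * (maxRank r : ℝ) ^ 3) := by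
  have hN : ∀ k, n k ≤ maxMode n := fun k => Finset.le_sup (Finset.mem_univ k)
  obtain ⟨hρ, hr'⟩ := le_maxRank hd hr
  have h1 := cost_hessProg_le hN hr' ((hn ⟨0, by omega⟩).trans (hN _)) hρ (p (doubleRank r))
  have h2 := hp _ (isRankVector_doubleRank hr)
  obtain ⟨h3, h4⟩ := hF.doubleRank_le hr
  have h5 : ((hessProg n r (p (doubleRank r))).cost : ℝ) ≤ 36 * ((p (doubleRank r)).cost : ℝ) +
      77 * ((d : ℝ) * (maxMode n : ℝ) * (maxRank r : ℝ) ^ 3) := by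
    rw [mul_assoc (d : ℝ)]
    exact_mod_cast h1
  have h6 : 0 ≤ (d : ℝ) * (maxMode n : ℝ) * (maxRank r : ℝ) ^ 3 := by positivity
  have h7 : 0 ≤ |K| * 2 ^ q := by positivity
  have h8 := mul_nonneg h7 h6
  nlinarith

end Cost

end

end TTAD

open TTAD

/-! ### The main theorem. -/

theorem mainTheorem2 (q : ℕ) (K : ℝ) :
    ∃ C : ℝ, ∀ (d : ℕ) (_ : 2 ≤ d) (n : Fin d → ℕ) (_ : ∀ k, 1 ≤ n k)
      (D : Set (Tensor n)) (_ : IsOpen D) (f : Tensor n → ℝ) (_ : ContDiffOn ℝ ∞ f D)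
      (p : ∀ r : Fin (d + 1) → ℕ, Prog (CoreIdx n r) Unit) (_ : Evaluates p f D)
      (F : (Fin (d + 1) → ℕ) → ℝ) (_ : PolynomialInRanks q K F)
      (_ : ∀ r, IsRankVector r → ((p r).cost : ℝ) ≤ F r)
      (r : Fin (d + 1) → ℕ) (_ : IsRankVector r),
      ((hessProg n r (p (doubleRank r))).cost : ℝ) ≤
          C * (F r + (d : ℝ) * (maxMode n : ℝ) * (maxRank r : ℝ) ^ 3) ∧
      ∀ (G U S V : CoreIdx n r → ℝ) (X : Tensor n), X = tt G → X ∈ ttManifold n r → X ∈ D →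
        U = (fun x => (orthogonalize n r).eval G (.U x)) →
        S = (fun x => (orthogonalize n r).eval G (.S x)) →
        V = (fun x => (orthogonalize n r).eval G (.V x)) →
        IsOrthogonalization X U S V ∧
        ∀ Z ∈ tangentSpace r X,
          (∃ δ : CoreIdx n r → ℝ, Gauge U δ ∧ tangentVector U V δ = Z) ∧
          ∀ δ : CoreIdx n r → ℝ, Gauge U δ → tangentVector U V δ = Z →
            (∀ R : CoreIdx n r → ℝ, tangentVector U V R ∈ D →
              (wProg n r (p (doubleRank r))).eval (WVar.values R U V δ) () =
                ⟪(tangentSpace r X).starProjection (gradient f (tangentVector U V R)), Z⟫_ℝ) ∧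
            (hessProg n r (p (doubleRank r))).Regular (HessVar.values G δ) ∧
            tt ((hessProg n r (p (doubleRank r))).eval (HessVar.values G δ)) =
              (tangentSpace r X).starProjection (fderiv ℝ (gradient f) X Z) := by
  refine ⟨36 * (|K| * 2 ^ q) + 77, ?_⟩
  intro d hd n hn D hD f hf p hp F hF hpF r hr
  refine ⟨cost_hessProg_le_of_polynomialInRanks hd hn hF hpF hr, ?_⟩
  intro G U S V X hX hXr hXD hU hS hV
  have hd0 : d ≠ 0 := by omega
  have hr2 := isRankVector_doubleRank hr
  obtain ⟨hreg, horth⟩ := orthogonalize_spec hn hr.1 hr.2.1 G (hX ▸ hXr)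
  rw [← hX, ← hU, ← hS, ← hV] at horth
  have hK := tangentSpace_eq_range hn hXr horth
  refine ⟨horth, fun Z hZ => ⟨?_, fun δ hδ hδZ => ⟨fun R hR => ?_, ?_⟩⟩⟩
  · rw [hK] at hZ
    obtain ⟨δ, hδ⟩ := hZ
    obtain ⟨δ', h1, h2⟩ := exists_gauge V horth.left δ
    exact ⟨δ', h1, h2.trans hδ⟩
  -- The projection is self-adjoint and fixes the tangent vector `Z`, so it may be inserted on the
  -- gradient.
  · rw [eval_wProg_eq_inner hd0 hD hf hp hr2 R U V hR hδ, hδZ,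
      Submodule.inner_starProjection_left_eq_right, Submodule.starProjection_eq_self_iff.2 hZ]
  · have hS0 := tangentVector_first hd0 horth
    have hS0D : tangentVector U V (fun x => if x.1.val = 0 then S x else 0) ∈ D := by
      rw [hS0]
      exact hXD
    obtain ⟨h1, h2⟩ := hessProg_spec hd0 (p (doubleRank r)) G δ hU hS hV rfl
    refine ⟨h1 hreg (regular_wProg _ _ _ _ _ (eval_gProg hd0 hp hr2 _ U V hS0D).1), ?_⟩
    rw [h2, starProjection_eq_tangentVector hr.1 hr.2.1 horth.left horth.right hK]
    intro H
    rw [sum_grad_wProg hd0 hD hf hp hr2 _ U V hS0D hδ, hS0, hδZ]
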